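/- Let $k=\mathbb F_q$ be a finite field of odd characteristic, let $\psi$ be a nontrivial (complex-valued) additive character of $k$, and let $\epsilon$ be the Legendre symbol of $k$. Let $\omega_\psi$ be the Weil representation of $\mathrm{SL}_2(k)$ on the space of all functions $\phi:k\to\mathbb C$, i.e. the representation determined by $$\omega_\psi\begin{pmatrix}a&\\&a^{-1}\end{pmatrix}\phi(\xi)=\epsilon(a)\phi(a\xi),\qquad \omega_\psi\begin{pmatrix}1&b\\&1\end{pmatrix}\phi(\xi)=\psi(b\xi^2)\phi(\xi),$$ $$\omega_\psi\begin{pmatrix}&b\\-b^{-1}&\end{pmatrix}\phi(\xi)=\frac1{\gamma(b,\psi)}\sum_{x\in k}\psi(2bx\xi)\phi(x),\qquad \gamma(b,\psi)=\sum_{x\in k}\psi(-bx^2),$$ where $a\in k^\times$ in the first formula, $b\in k$ in the second and $b\in k^\times$ in the third. For a character $\chi:k^\times\to\mathbb C^\times$ let $I(\chi)$ be the representation of $\mathrm{SL}_2(k)$ induced from the character $\begin{pmatrix}a&b\\&a^{-1}\end{pmatrix}\mapsto\chi(a)$ of the Borel subgroup of upper triangular matrices. Let $\pi$ be an irreducible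 complex representation of $\mathrm{SL}_2(k)$ which is not isomorphic to $I(\chi_1)$ for any character $\chi_1$ of $k^\times$ with $\chi_1^2\neq1$. Then $\pi\otimes\omega_\psi$ is multiplicity free as a representation of $\mathrm{SL}_2(k)$, i.e. $\dim\mathrm{Hom}_{\mathrm{SL}_2(k)}(\sigma,\pi\otimes\omega_\psi)\le1$ for every irreducible complex representation $\sigma$ of $\mathrm{SL}_2(k)$. -/

import Mathlib

open scoped MatrixGroups

noncomputable section

namespace SLTwo

variable {k : Type*} [Field k] [Fintype k] [DecidableEq k]

/-! ### Quadratic Gauss sums -/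

/-- `γ(b, ψ) = ∑ x, ψ(-b x²)`. -/
def gam {k : Type*} [Field k] [Fintype k] (ψ : AddChar k ℂ) (b : k) : ℂ := ∑ x : k, ψ (-(b * x ^ 2))

/-- The Legendre symbol `ε` of `k`, with complex values. -/
def eps (a : k) : ℂ := ((quadraticChar k a : ℤ) : ℂ)

lemma eps_mul (a b : k) : eps (a * b) = eps a * eps b := by
  rw [eps, eps, eps, map_mul, Int.cast_mul]

lemma eps_one : eps (1 : k) = 1 := by simp [eps]

lemma eps_mul_self {a : k} (ha : a ≠ 0) : eps a * eps a = 1 := by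
  have := quadraticChar_sq_one ha
  rw [eps, ← Int.cast_mul, ← sq, this, Int.cast_one]

lemma eps_ne_zero {a : k} (ha : a ≠ 0) : eps a ≠ 0 := by
  intro h
  have := eps_mul_self ha
  simp [h] at this

lemma eps_inv {a : k} (ha : a ≠ 0) : eps a⁻¹ = eps a := by
  have h1 : eps a * eps a⁻¹ = 1 := by rw [← eps_mul, mul_inv_cancel₀ ha, eps_one]
  exact mul_left_cancel₀ (eps_ne_zero ha) (h1.trans (eps_mul_self ha).symm)

/-- The Legendre symbol as a complex multiplicative character. -/
def epsChar (k : Type*) [Field k] [Fintype k] [DecidableEq k] : MulChar k ℂ :=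
  (quadraticChar k).ringHomComp (Int.castRingHom ℂ)

lemma epsChar_apply (a : k) : epsChar k a = eps a := rfl

lemma epsChar_ne_one (hk : ringChar k ≠ 2) : epsChar k ≠ 1 :=
  (MulChar.ringHomComp_ne_one_iff (RingHom.injective_int (Int.castRingHom ℂ))).mpr
    (quadraticChar_ne_one hk)

lemma sum_sq_eq (hk : ringChar k ≠ 2) (f : k → ℂ) :
    ∑ x : k, f (x ^ 2) = ∑ y : k, (1 + eps y) * f y := by
  rw [← Finset.sum_fiberwise_of_maps_to (s := Finset.univ) (t := Finset.univ)
    (g := fun x : k => x ^ 2) (fun _ _ => Finset.mem_univ _)]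
  refine Finset.sum_congr rfl fun y _ => ?_
  have h := quadraticChar_card_sqrts hk y
  have h2 : (({x : k | x ^ 2 = y}.toFinset.card : ℤ) : ℂ) = eps y + 1 := by
    rw [h]; simp [eps]
  rw [Finset.sum_congr rfl (g := fun _ => f y)
    (by intro x hx; rw [(Finset.mem_filter.mp hx).2])]
  rw [Finset.sum_const, nsmul_eq_mul, add_comm 1, ← h2]
  congr 1
  rw [Int.cast_natCast]
  congr 2
  ext x; simp

lemma gam_eq (hk : ringChar k ≠ 2) {ψ : AddChar k ℂ} (hψ : ψ ≠ 1) {b : k} (hb : b ≠ 0) :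
    gam ψ b = eps (-b) * gaussSum (epsChar k) ψ := by
  have h0 : gam ψ b = gaussSum (epsChar k) (ψ.mulShift (-b)) := by
    have := sum_sq_eq hk (fun y => ψ (-b * y))
    simp only [gam, ← neg_mul]
    rw [this]
    simp only [add_mul, one_mul, Finset.sum_add_distrib, gaussSum, AddChar.mulShift_apply,
      epsChar_apply]
    have h1 : ∑ y : k, ψ (-b * y) = 0 := by
      have h2 := AddChar.sum_mulShift (-b) (AddChar.IsPrimitive.of_ne_one hψ)
      rw [if_neg (neg_ne_zero.mpr hb), Nat.cast_zero] at h2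
      rw [← h2]
      exact Finset.sum_congr rfl fun y _ => by rw [mul_comm]
    rw [h1, zero_add]
  have h3 := gaussSum_mulShift (epsChar k) ψ (Units.mk0 (-b) (neg_ne_zero.mpr hb))
  rw [Units.val_mk0, epsChar_apply] at h3
  rw [h0, ← h3, ← mul_assoc, eps_mul_self (neg_ne_zero.mpr hb), one_mul]

lemma gaussSum_sq_eq (hk : ringChar k ≠ 2) {ψ : AddChar k ℂ} (hψ : ψ ≠ 1) :
    gaussSum (epsChar k) ψ * gaussSum (epsChar k) ψ = eps (-1 : k) * Fintype.card k := by
  have := gaussSum_sq (epsChar_ne_one hk)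
    ((quadraticChar_isQuadratic k).comp (Int.castRingHom ℂ))
    (AddChar.IsPrimitive.of_ne_one hψ)
  rw [sq] at this
  exact this

lemma card_ne_zero {k : Type*} [Field k] [Fintype k] : (Fintype.card k : ℂ) ≠ 0 := Nat.cast_ne_zero.mpr Fintype.card_ne_zero

lemma gam_ne_zero (hk : ringChar k ≠ 2) {ψ : AddChar k ℂ} (hψ : ψ ≠ 1) {b : k} (hb : b ≠ 0) :
    gam ψ b ≠ 0 := by
  rw [gam_eq hk hψ hb]
  refine mul_ne_zero (eps_ne_zero (neg_ne_zero.mpr hb)) fun h => ?_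
  have := gaussSum_sq_eq hk hψ
  rw [h, zero_mul] at this
  exact mul_ne_zero (eps_ne_zero (neg_ne_zero.mpr one_ne_zero)) card_ne_zero this.symm

lemma gam_mul (hk : ringChar k ≠ 2) {ψ : AddChar k ℂ} (hψ : ψ ≠ 1) {a b : k}
    (ha : a ≠ 0) (hb : b ≠ 0) : gam ψ (a * b) = eps a * gam ψ b := by
  rw [gam_eq hk hψ hb, gam_eq hk hψ (mul_ne_zero ha hb), ← mul_assoc, ← eps_mul, mul_neg]

lemma gam_one_mul_gam_neg_one (hk : ringChar k ≠ 2) {ψ : AddChar k ℂ} (hψ : ψ ≠ 1) :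
    gam ψ 1 * gam ψ (-1) = Fintype.card k := by
  have h1 : (-1 : k) ≠ 0 := neg_ne_zero.mpr one_ne_zero
  rw [gam_eq hk hψ one_ne_zero, gam_eq hk hψ h1, neg_neg, eps_one, one_mul, mul_assoc,
    gaussSum_sq_eq hk hψ, ← mul_assoc, eps_mul_self h1, one_mul]

/-- Completing the square. -/
lemma sum_quadratic {k : Type*} [Field k] [Fintype k] (ψ : AddChar k ℂ) {a c : k} (ha : a ≠ 0) (hc : c ≠ 0) (t : k) :
    ∑ y : k, ψ ((a * y ^ 2) / c + 2 * t * y / c) = ψ (-(t ^ 2) / (a * c)) * gam ψ (-(a / c)) := by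
  rw [gam, Finset.mul_sum]
  refine Fintype.sum_equiv (Equiv.addRight (t / a)) _ _ fun y => ?_
  rw [← AddChar.map_add_eq_mul]
  congr 1
  simp only [Equiv.coe_addRight]
  field_simp
  ring

/-! ### The Weil representation -/

/-- The operator on the space of functions `k → ℂ` by which a matrix `!![a, b; c, d]` of
determinant one acts in the Weil representation attached to `ψ`. -/
def weilFun (ψ : AddChar k ℂ) (g : SL(2, k)) (φ : k → ℂ) (ξ : k) : ℂ :=
  if g 1 0 = 0 then
    eps (g 0 0) * ψ (g 0 0 * g 0 1 * ξ ^ 2) * φ (g 0 0 * ξ)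
  else
    (gam ψ (-(g 1 0)⁻¹))⁻¹ *
      ∑ x : k, ψ ((g 0 0 * ξ ^ 2 - 2 * x * ξ + g 1 1 * x ^ 2) / g 1 0) * φ x

/-- `weilFun` as a linear map. -/
def weilOp (ψ : AddChar k ℂ) (g : SL(2, k)) : (k → ℂ) →ₗ[ℂ] (k → ℂ) where
  toFun := weilFun ψ g
  map_add' φ₁ φ₂ := by
    funext ξ
    simp only [weilFun, Pi.add_apply]
    split_ifs
    · ring
    · rw [← mul_add, ← Finset.sum_add_distrib]
      simp only [mul_add]
  map_smul' c φ := by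
    funext ξ
    simp only [weilFun, Pi.smul_apply, smul_eq_mul, RingHom.id_apply]
    split_ifs
    · ring
    · rw [mul_left_comm, Finset.mul_sum _ _ c]
      simp only [mul_left_comm c]

lemma weilOp_apply_of_eq (ψ : AddChar k ℂ) {g : SL(2, k)} (h : g 1 0 = 0) (φ : k → ℂ) (ξ : k) :
    weilOp ψ g φ ξ = eps (g 0 0) * ψ (g 0 0 * g 0 1 * ξ ^ 2) * φ (g 0 0 * ξ) := by
  change weilFun ψ g φ ξ = _
  rw [weilFun, if_pos h]

lemma weilOp_apply_of_ne (ψ : AddChar k ℂ) {g : SL(2, k)} (h : g 1 0 ≠ 0) (φ : k → ℂ) (ξ : k) :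
    weilOp ψ g φ ξ = (gam ψ (-(g 1 0)⁻¹))⁻¹ *
      ∑ x : k, ψ ((g 0 0 * ξ ^ 2 - 2 * x * ξ + g 1 1 * x ^ 2) / g 1 0) * φ x := by
  change weilFun ψ g φ ξ = _
  rw [weilFun, if_neg h]

/-- The matrix `diag(a, a⁻¹)`. -/
def diagMat (a : kˣ) : SL(2, k) :=
  ⟨!![(a : k), 0; 0, (a : k)⁻¹], by simp [Matrix.det_fin_two]⟩

/-- The matrix `!![1, b; 0, 1]`. -/
def upperMat (b : k) : SL(2, k) :=
  ⟨!![1, b; 0, 1], by simp [Matrix.det_fin_two]⟩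

/-- The matrix `!![0, b; -b⁻¹, 0]`. -/
def weylMat (b : kˣ) : SL(2, k) :=
  ⟨!![0, (b : k); -(b : k)⁻¹, 0], by simp [Matrix.det_fin_two]⟩

lemma weilOp_diagMat (ψ : AddChar k ℂ) (a : kˣ) (φ : k → ℂ) (ξ : k) :
    weilOp ψ (diagMat a) φ ξ = eps (a : k) * φ (a * ξ) := by
  rw [weilOp_apply_of_eq ψ (by simp [diagMat])]
  simp [diagMat]

lemma weilOp_upperMat (ψ : AddChar k ℂ) (b : k) (φ : k → ℂ) (ξ : k) :
    weilOp ψ (upperMat b) φ ξ = ψ (b * ξ ^ 2) * φ ξ := by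
  rw [weilOp_apply_of_eq ψ (by simp [upperMat])]
  simp [upperMat, eps_one]

lemma weilOp_weylMat (ψ : AddChar k ℂ) (b : kˣ) (φ : k → ℂ) (ξ : k) :
    weilOp ψ (weylMat b) φ ξ = (gam ψ b)⁻¹ * ∑ x : k, ψ (2 * b * x * ξ) * φ x := by
  rw [weilOp_apply_of_ne ψ (by simp [weylMat])]
  simp only [weylMat, Matrix.SpecialLinearGroup.coe_mk, Matrix.of_apply, Matrix.cons_val', Matrix.cons_val_zero,
    Matrix.cons_val_one, Matrix.cons_val_fin_one, inv_neg, inv_inv, neg_neg]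
  congr 1
  refine Finset.sum_congr rfl fun x _ => ?_
  congr 2
  have := b.ne_zero
  field_simp
  ring

lemma mul_entries {k : Type*} [Field k] (g h : SL(2, k)) (i j : Fin 2) :
    (g * h) i j = g i 0 * h 0 j + g i 1 * h 1 j := by
  simp [Matrix.SpecialLinearGroup.coe_mul, Matrix.mul_apply, Fin.sum_univ_two]

lemma det_entries {k : Type*} [Field k] (g : SL(2, k)) : g 0 0 * g 1 1 - g 0 1 * g 1 0 = 1 := by
  have := g.det_coe
  rwa [Matrix.det_fin_two] at this

lemma weilOp_upperMat_mul (ψ : AddChar k ℂ) (b : k) (h : SL(2, k)) :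
    weilOp ψ (upperMat b * h) = weilOp ψ (upperMat b) * weilOp ψ h := by
  refine LinearMap.ext fun φ => funext fun ξ => ?_
  have e00 : (upperMat b * h) 0 0 = h 0 0 + b * h 1 0 := by rw [mul_entries]; simp [upperMat]
  have e01 : (upperMat b * h) 0 1 = h 0 1 + b * h 1 1 := by rw [mul_entries]; simp [upperMat]
  have e10 : (upperMat b * h) 1 0 = h 1 0 := by rw [mul_entries]; simp [upperMat]
  have e11 : (upperMat b * h) 1 1 = h 1 1 := by rw [mul_entries]; simp [upperMat]
  have hd := det_entries h
  rw [Module.End.mul_apply, weilOp_upperMat]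
  by_cases hc : h 1 0 = 0
  · rw [weilOp_apply_of_eq ψ (e10.trans hc), weilOp_apply_of_eq ψ hc, e00, e01, hc, mul_zero,
      add_zero]
    rw [hc, mul_zero, sub_zero] at hd
    have : h 0 0 * (h 0 1 + b * h 1 1) * ξ ^ 2 = b * ξ ^ 2 + h 0 0 * h 0 1 * ξ ^ 2 := by
      linear_combination (b * ξ ^ 2) * hd
    rw [this, AddChar.map_add_eq_mul]
    ring
  · rw [weilOp_apply_of_ne ψ (by rwa [e10]), weilOp_apply_of_ne ψ hc, e00, e10, e11,
      mul_left_comm (ψ _), Finset.mul_sum _ _ (ψ _)]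
    congr 1
    refine Finset.sum_congr rfl fun x _ => ?_
    rw [← mul_assoc, ← AddChar.map_add_eq_mul]
    congr 2
    field_simp
    ring

lemma weilOp_diagMat_mul (hk : ringChar k ≠ 2) {ψ : AddChar k ℂ} (hψ : ψ ≠ 1) (a : kˣ)
    (h : SL(2, k)) :
    weilOp ψ (diagMat a * h) = weilOp ψ (diagMat a) * weilOp ψ h := by
  refine LinearMap.ext fun φ => funext fun ξ => ?_
  have ha := a.ne_zero
  have e00 : (diagMat a * h) 0 0 = a * h 0 0 := by rw [mul_entries]; simp [diagMat]
  have e01 : (diagMat a * h) 0 1 = a * h 0 1 := by rw [mul_entries]; simp [diagMat]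
  have e10 : (diagMat a * h) 1 0 = (a : k)⁻¹ * h 1 0 := by rw [mul_entries]; simp [diagMat]
  have e11 : (diagMat a * h) 1 1 = (a : k)⁻¹ * h 1 1 := by rw [mul_entries]; simp [diagMat]
  rw [Module.End.mul_apply, weilOp_diagMat]
  by_cases hc : h 1 0 = 0
  · rw [weilOp_apply_of_eq ψ (by rw [e10, hc, mul_zero]), weilOp_apply_of_eq ψ hc, e00, e01,
      eps_mul, ← mul_assoc (h 0 0), ← mul_assoc, ← mul_assoc, mul_comm (h 0 0) (a : k)]
    have e : (a : k) * h 0 0 * a * h 0 1 * ξ ^ 2 = h 0 0 * h 0 1 * (a * ξ) ^ 2 := by ring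
    rw [e]
    ring_nf
  · rw [weilOp_apply_of_ne ψ (by rw [e10]; exact mul_ne_zero (inv_ne_zero ha) hc),
      weilOp_apply_of_ne ψ hc, e00, e10, e11]
    have e : -((a : k)⁻¹ * h 1 0)⁻¹ = a * -(h 1 0)⁻¹ := by
      rw [mul_inv, inv_inv, mul_neg]
    rw [e, gam_mul hk hψ ha (neg_ne_zero.mpr (inv_ne_zero hc)), mul_inv, mul_assoc,
      inv_eq_of_mul_eq_one_right (eps_mul_self ha)]
    congr 2
    refine Finset.sum_congr rfl fun x _ => ?_
    congr 2
    field_simp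

lemma weilOp_weylMat_mul (hk : ringChar k ≠ 2) {ψ : AddChar k ℂ} (hψ : ψ ≠ 1)
    (h : SL(2, k)) :
    weilOp ψ (weylMat 1 * h) = weilOp ψ (weylMat 1) * weilOp ψ h := by
  refine LinearMap.ext fun φ => funext fun ξ => ?_
  have e00 : (weylMat (1 : kˣ) * h) 0 0 = h 1 0 := by rw [mul_entries]; simp [weylMat]
  have e01 : (weylMat (1 : kˣ) * h) 0 1 = h 1 1 := by rw [mul_entries]; simp [weylMat]
  have e10 : (weylMat (1 : kˣ) * h) 1 0 = -h 0 0 := by rw [mul_entries]; simp [weylMat]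
  have e11 : (weylMat (1 : kˣ) * h) 1 1 = -h 0 1 := by rw [mul_entries]; simp [weylMat]
  have hd := det_entries h
  rw [Module.End.mul_apply, weilOp_weylMat, Units.val_one]
  by_cases hc : h 1 0 = 0
  · have ha : h 0 0 ≠ 0 := by
      intro h0; simp [h0, hc] at hd
    rw [weilOp_apply_of_ne ψ (by rw [e10]; exact neg_ne_zero.mpr ha), e00, e10, e11, hc]
    have e : -(-h 0 0)⁻¹ = (h 0 0)⁻¹ * 1 := by rw [inv_neg, neg_neg, mul_one]
    rw [e, gam_mul hk hψ (inv_ne_zero ha) one_ne_zero, eps_inv ha, mul_inv,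
      inv_eq_of_mul_eq_one_right (eps_mul_self ha), mul_comm (eps _), mul_assoc,
      Finset.mul_sum _ _ (eps _)]
    congr 1
    refine (Fintype.sum_equiv (Equiv.mulLeft₀ (h 0 0) ha) _ _ fun y => ?_).symm
    rw [weilOp_apply_of_eq ψ hc, Equiv.mulLeft₀_apply]
    have e2 : (0 * ξ ^ 2 - 2 * (h 0 0 * y) * ξ + -h 0 1 * (h 0 0 * y) ^ 2) / -h 0 0
        = 2 * 1 * y * ξ + h 0 0 * h 0 1 * y ^ 2 := by
      field_simp
      ring
    rw [e2, AddChar.map_add_eq_mul]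
    ring
  · simp only [weilOp_apply_of_ne ψ hc]
    have hswap : (gam ψ 1)⁻¹ * ∑ y : k, ψ (2 * 1 * y * ξ) * ((gam ψ (-(h 1 0)⁻¹))⁻¹ *
          ∑ x : k, ψ ((h 0 0 * y ^ 2 - 2 * x * y + h 1 1 * x ^ 2) / h 1 0) * φ x)
        = (gam ψ 1)⁻¹ * (gam ψ (-(h 1 0)⁻¹))⁻¹ * ∑ x : k, (∑ y : k, ψ (2 * 1 * y * ξ +
          (h 0 0 * y ^ 2 - 2 * x * y + h 1 1 * x ^ 2) / h 1 0)) * φ x := by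
      rw [mul_assoc]
      congr 1
      simp only [Finset.mul_sum, Finset.sum_mul]
      rw [Finset.sum_comm]
      refine Finset.sum_congr rfl fun x _ => Finset.sum_congr rfl fun y _ => ?_
      rw [AddChar.map_add_eq_mul]
      ring
    rw [hswap]
    by_cases ha : h 0 0 = 0
    · rw [weilOp_apply_of_eq ψ (by rw [e10, ha, neg_zero]), e00, e01]
      have h2 : (2 : k) ≠ 0 := Ring.two_ne_zero hk
      have hinner : ∀ x : k, ∑ y : k, ψ (2 * 1 * y * ξ +
          (h 0 0 * y ^ 2 - 2 * x * y + h 1 1 * x ^ 2) / h 1 0) =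
          if x = h 1 0 * ξ then ψ (h 1 0 * h 1 1 * ξ ^ 2) * (Fintype.card k : ℂ) else 0 := by
        intro x
        have e3 : ∀ y : k, ψ (2 * 1 * y * ξ +
            (h 0 0 * y ^ 2 - 2 * x * y + h 1 1 * x ^ 2) / h 1 0) =
            ψ (h 1 1 * x ^ 2 / h 1 0) * ψ (y * (2 * (ξ - x / h 1 0))) := by
          intro y
          rw [← AddChar.map_add_eq_mul, ha]
          congr 1
          field_simp
          ring
        rw [Finset.sum_congr rfl fun y _ => e3 y, ← Finset.mul_sum,
          AddChar.sum_mulShift _ (AddChar.IsPrimitive.of_ne_one hψ)]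
        by_cases hx : x = h 1 0 * ξ
        · have e4 : 2 * (ξ - x / h 1 0) = 0 := by
            rw [hx, mul_div_cancel_left₀ _ hc, sub_self, mul_zero]
          rw [if_pos e4, if_pos hx, hx]
          congr 2
          field_simp
        · have e4 : 2 * (ξ - x / h 1 0) ≠ 0 := by
            refine mul_ne_zero h2 fun h3 => hx ?_
            rw [sub_eq_zero.mp h3, mul_div_cancel₀ _ hc]
          rw [if_neg e4, if_neg hx, Nat.cast_zero, mul_zero]
      simp only [hinner, ite_mul, zero_mul, Finset.sum_ite_eq', Finset.mem_univ, if_true]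
      have e5 : -(h 1 0)⁻¹ = (h 1 0)⁻¹ * (-1) := by rw [mul_neg_one]
      rw [e5, gam_mul hk hψ (inv_ne_zero hc) (neg_ne_zero.mpr one_ne_zero), eps_inv hc,
        ← gam_one_mul_gam_neg_one hk hψ]
      have g1 := gam_ne_zero hk hψ (one_ne_zero (α := k))
      have g2 := gam_ne_zero hk hψ (neg_ne_zero.mpr (one_ne_zero (α := k)))
      have g3 := eps_ne_zero hc
      have g4 := eps_mul_self hc
      field_simp
      linear_combination (ψ (h 1 0 * h 1 1 * ξ ^ 2) * φ (h 1 0 * ξ)) * g4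
    · rw [weilOp_apply_of_ne ψ (by rw [e10]; exact neg_ne_zero.mpr ha), e00, e10, e11]
      have hinner : ∀ x : k, ∑ y : k, ψ (2 * 1 * y * ξ +
          (h 0 0 * y ^ 2 - 2 * x * y + h 1 1 * x ^ 2) / h 1 0) =
          ψ ((h 1 0 * ξ ^ 2 - 2 * x * ξ + -h 0 1 * x ^ 2) / -h 0 0) *
            gam ψ (-(h 0 0 / h 1 0)) := by
        intro x
        have e3 : ∀ y : k, ψ (2 * 1 * y * ξ +
            (h 0 0 * y ^ 2 - 2 * x * y + h 1 1 * x ^ 2) / h 1 0) =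
            ψ (h 1 1 * x ^ 2 / h 1 0) *
              ψ ((h 0 0 * y ^ 2) / h 1 0 + 2 * (h 1 0 * ξ - x) * y / h 1 0) := by
          intro y
          rw [← AddChar.map_add_eq_mul]
          congr 1
          field_simp
          ring
        rw [Finset.sum_congr rfl fun y _ => e3 y, ← Finset.mul_sum, sum_quadratic ψ ha hc,
          ← mul_assoc, ← AddChar.map_add_eq_mul]
        congr 2
        field_simp
        linear_combination x ^ 2 * hd
      simp only [hinner]
      have e4 : -(h 0 0 / h 1 0) = h 0 0 * -(h 1 0)⁻¹ := by rw [mul_neg, div_eq_mul_inv]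
      have e5 : -(-h 0 0)⁻¹ = (h 0 0)⁻¹ * 1 := by rw [inv_neg, neg_neg, mul_one]
      have g1 := gam_ne_zero hk hψ (one_ne_zero (α := k))
      have g2 := gam_ne_zero hk hψ (neg_ne_zero.mpr (inv_ne_zero hc))
      rw [e4, e5, gam_mul hk hψ ha (neg_ne_zero.mpr (inv_ne_zero hc)),
        gam_mul hk hψ (inv_ne_zero ha) one_ne_zero, eps_inv ha, mul_inv,
        inv_eq_of_mul_eq_one_right (eps_mul_self ha), Finset.mul_sum, Finset.mul_sum]
      refine Finset.sum_congr rfl fun x _ => ?_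
      generalize gam ψ (-(h 1 0)⁻¹) = G at g2 ⊢
      generalize ψ ((h 1 0 * ξ ^ 2 - 2 * x * ξ + -h 0 1 * x ^ 2) / -h 0 0) = P
      field_simp

/-- The Bruhat decomposition. -/
lemma exists_bruhat {k : Type*} [Field k] [DecidableEq k] (g : SL(2, k)) :
    (∃ (a : kˣ) (b : k), g = upperMat b * diagMat a) ∨
    (∃ (a : kˣ) (b c : k), g = upperMat b * (diagMat a * (weylMat 1 * upperMat c))) := by
  have hd := det_entries g
  by_cases hc : g 1 0 = 0
  · left
    have ha : g 0 0 ≠ 0 := by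
      intro h0; simp [h0, hc] at hd
    refine ⟨Units.mk0 _ ha, g 0 0 * g 0 1, ?_⟩
    rw [hc, mul_zero, sub_zero] at hd
    ext i j
    rw [mul_entries]
    fin_cases i <;> fin_cases j
    · simp [upperMat, diagMat]
    · simp [upperMat, diagMat]
      field_simp
    · simp [upperMat, diagMat, hc]
    · simp [upperMat, diagMat]
      exact eq_inv_of_mul_eq_one_right hd
  · right
    refine ⟨Units.mk0 _ (neg_ne_zero.mpr (inv_ne_zero hc)), g 0 0 / g 1 0, g 1 1 / g 1 0, ?_⟩
    ext i j
    simp only [mul_entries]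
    fin_cases i <;> fin_cases j
    · simp [upperMat, diagMat, weylMat]
      field_simp
    · simp [upperMat, diagMat, weylMat]
      field_simp
      linear_combination -hd
    · simp [upperMat, diagMat, weylMat]
    · simp [upperMat, diagMat, weylMat]
      field_simp

lemma weilOp_one (ψ : AddChar k ℂ) : weilOp ψ (1 : SL(2, k)) = 1 := by
  refine LinearMap.ext fun φ => funext fun ξ => ?_
  rw [weilOp_apply_of_eq ψ (by simp)]
  simp [eps_one]

lemma weilOp_mul (hk : ringChar k ≠ 2) {ψ : AddChar k ℂ} (hψ : ψ ≠ 1) (g h : SL(2, k)) :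
    weilOp ψ (g * h) = weilOp ψ g * weilOp ψ h := by
  rcases exists_bruhat g with ⟨a, b, rfl⟩ | ⟨a, b, c, rfl⟩
  · simp only [mul_assoc, weilOp_upperMat_mul, weilOp_diagMat_mul hk hψ]
  · simp only [mul_assoc, weilOp_upperMat_mul, weilOp_diagMat_mul hk hψ, weilOp_weylMat_mul hk hψ]

/-- The Weil representation `ω_ψ` of `SL₂(k)`, for a finite field `k` of odd characteristic and a
nontrivial additive character `ψ`, on the space of all functions `k → ℂ`. By `weilRep_diagMat`,
`weilRep_upperMat` and `weilRep_weylMat` below, and since these matrices generate `SL₂(k)`, it is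
the representation given by the usual formulas
* `(ω_ψ(diag(a, a⁻¹)) φ)(ξ) = ε(a) φ(a ξ)`,
* `(ω_ψ(!![1, b; 0, 1]) φ)(ξ) = ψ(b ξ²) φ(ξ)`,
* `(ω_ψ(!![0, b; -b⁻¹, 0]) φ)(ξ) = γ(b, ψ)⁻¹ ∑ x, ψ(2 b x ξ) φ(x)`. -/
def weilRep (hk : ringChar k ≠ 2) (ψ : AddChar k ℂ) (hψ : ψ ≠ 1) :
    Representation ℂ SL(2, k) (k → ℂ) where
  toFun := weilOp ψ
  map_one' := weilOp_one ψ
  map_mul' := weilOp_mul hk hψ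

lemma weilRep_diagMat (hk : ringChar k ≠ 2) (ψ : AddChar k ℂ) (hψ : ψ ≠ 1) (a : kˣ)
    (φ : k → ℂ) (ξ : k) :
    weilRep hk ψ hψ (diagMat a) φ ξ = (quadraticChar k a : ℤ) * φ (a * ξ) :=
  weilOp_diagMat ψ a φ ξ

lemma weilRep_upperMat (hk : ringChar k ≠ 2) (ψ : AddChar k ℂ) (hψ : ψ ≠ 1) (b : k)
    (φ : k → ℂ) (ξ : k) :
    weilRep hk ψ hψ (upperMat b) φ ξ = ψ (b * ξ ^ 2) * φ ξ :=
  weilOp_upperMat ψ b φ ξ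

lemma weilRep_weylMat (hk : ringChar k ≠ 2) (ψ : AddChar k ℂ) (hψ : ψ ≠ 1) (b : kˣ)
    (φ : k → ℂ) (ξ : k) :
    weilRep hk ψ hψ (weylMat b) φ ξ =
      (∑ x : k, ψ (-(b * x ^ 2)))⁻¹ * ∑ x : k, ψ (2 * b * x * ξ) * φ x :=
  weilOp_weylMat ψ b φ ξ

/-- The matrices with the prescribed action generate, so the formulas determine the
representation. -/
lemma weilRep_unique (hk : ringChar k ≠ 2) (ψ : AddChar k ℂ) (hψ : ψ ≠ 1)
    (ω : Representation ℂ SL(2, k) (k → ℂ))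
    (h₁ : ∀ (a : kˣ) (φ : k → ℂ) (ξ : k),
      ω (diagMat a) φ ξ = (quadraticChar k a : ℤ) * φ (a * ξ))
    (h₂ : ∀ (b : k) (φ : k → ℂ) (ξ : k), ω (upperMat b) φ ξ = ψ (b * ξ ^ 2) * φ ξ)
    (h₃ : ∀ (b : kˣ) (φ : k → ℂ) (ξ : k), ω (weylMat b) φ ξ =
      (∑ x : k, ψ (-(b * x ^ 2)))⁻¹ * ∑ x : k, ψ (2 * b * x * ξ) * φ x) :
    ω = weilRep hk ψ hψ := by
  have e₁ : ∀ a : kˣ, ω (diagMat a) = weilRep hk ψ hψ (diagMat a) := fun a =>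
    LinearMap.ext fun φ => funext fun ξ => by rw [h₁, weilRep_diagMat]
  have e₂ : ∀ b : k, ω (upperMat b) = weilRep hk ψ hψ (upperMat b) := fun b =>
    LinearMap.ext fun φ => funext fun ξ => by rw [h₂, weilRep_upperMat]
  have e₃ : ∀ b : kˣ, ω (weylMat b) = weilRep hk ψ hψ (weylMat b) := fun b =>
    LinearMap.ext fun φ => funext fun ξ => by rw [h₃, weilRep_weylMat]
  refine MonoidHom.ext fun g => ?_
  rcases exists_bruhat g with ⟨a, b, rfl⟩ | ⟨a, b, c, rfl⟩
  · simp only [map_mul, e₁, e₂]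
  · simp only [map_mul, e₁, e₂, e₃]

/-! ### Principal series -/

/-- The Borel subgroup of upper triangular matrices in `SL₂(k)`. -/
def borel (k : Type*) [Field k] : Subgroup SL(2, k) where
  carrier := {g | g 1 0 = 0}
  one_mem' := by simp
  mul_mem' {g h} hg hh := by
    change _ = _ at hg hh ⊢
    rw [mul_entries, hg, hh, zero_mul, mul_zero, add_zero]
  inv_mem' {g} hg := by
    change _ = _ at hg ⊢
    simp [Matrix.SpecialLinearGroup.coe_inv, Matrix.adjugate_fin_two, hg]

lemma borel_det {k : Type*} [Field k] (g : borel k) :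
    (g : SL(2, k)) 0 0 * (g : SL(2, k)) 1 1 = 1 := by
  have h := det_entries (g : SL(2, k))
  have h0 : (g : SL(2, k)) 1 0 = 0 := g.2
  rwa [h0, mul_zero, sub_zero] at h

/-- The homomorphism `!![a, b; 0, a⁻¹] ↦ a` from the Borel subgroup to `kˣ`, whose kernel is the
group of upper triangular unipotent matrices. -/
def borelDiag (k : Type*) [Field k] : borel k →* kˣ where
  toFun g := Units.mk0 ((g : SL(2, k)) 0 0) (left_ne_zero_of_mul_eq_one (borel_det g))
  map_one' := by ext; simp
  map_mul' g h := by
    ext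
    have h0 : (h : SL(2, k)) 1 0 = 0 := h.2
    simp only [Units.val_mk0, Units.val_mul, Subgroup.coe_mul]
    rw [mul_entries, h0, mul_zero, add_zero]

/-- A character `χ` of `kˣ`, viewed as a one-dimensional representation of the Borel subgroup that
is trivial on the upper triangular unipotent matrices. -/
def borelRep {k : Type*} [Field k] (χ : kˣ →* ℂˣ) : Representation ℂ (borel k) ℂ where
  toFun b := ((χ (borelDiag k b) : ℂˣ) : ℂ) • LinearMap.id
  map_one' := by simp; rfl
  map_mul' b₁ b₂ := by ext; simp [mul_comm]

/-- The representation `I(χ)` of `SL₂(k)` induced from the character `χ` of the Borel subgroup,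
realized on the functions `f : SL₂(k) → ℂ` with `f (b g) = χ(b) f(g)` for `b` in the Borel
subgroup, on which `SL₂(k)` acts by right translation. -/
def principalSeries {k : Type*} [Field k] (χ : kˣ →* ℂˣ) :
    Representation ℂ SL(2, k) (Representation.coindV (borel k).subtype (borelRep χ)) :=
  Representation.coind (borel k).subtype (borelRep χ)

end SLTwo

/-- A complex representation `ρ` of a group is multiplicity free if every irreducible
representation `σ` occurs in it at most once, i.e. if `dim Hom(σ, ρ) ≤ 1`. (For the finite groups
considered here, all irreducible representations are finite dimensional and hence have a model in
any given universe.) -/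
def Representation.IsMultiplicityFree.{w, u, v} {G : Type u} [Group G] {V : Type v} [AddCommGroup V]
    [Module ℂ V] (ρ : Representation ℂ G V) : Prop :=
  ∀ (W : Type w) [AddCommGroup W] [Module ℂ W] (σ : Representation ℂ G W),
    σ.IsIrreducible → Module.rank ℂ (Representation.IntertwiningMap σ ρ) ≤ 1

end

universe w

/-! The proof is a Gelfand trick. Put ρ = π ⊗ ω_ψ. A representation of a finite group is
multiplicity free once its endomorphism algebra is commutative (`isMultiplicityFree_of_commute`),
and every intertwiner is, up to the scalar |G|, its own average under conjugation. So it is enough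
that averages `conjSum` commute, and by Burnside's theorem only averages of π(h) ⊗ M, with M a
matrix on functions on k, need be considered.

The anti-involution of the trick sends (h, M) to (`flip h`, Mᵀ). It acts on pairs, so it is never
necessary to descend it to End(V). It is compatible with conjugation by ρ because the Weil matrix of
`flip g` is the transpose of that of g (`weilMatrix_flip`). If the average of π(h) ⊗ M is unchanged
by it (`conjSum_pureEnd_flip`), then reversing products shows that averages commute
(`conjSum_pureEnd_comm`).

For the invariance, the matrices ω(g) D ω(g)⁻¹ with D diagonal span all matrices
(`mem_of_weilMatrix_conj`), so M may be taken diagonal. Diagonal matrices commute with the action of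
the unipotent group U, so only ∑ₓ π(u(x) h u(-x)) matters. When h has nonzero lower left entry,
`flip h` is a U-conjugate of h. When h is upper triangular with distinct diagonal entries a, a⁻¹,
the sum is π(diag(a, a⁻¹)) times ∑ₓ π(u(x)), whose image lies in V^U, and the flip inverts a. The
hypothesis on π enters here: a torus character χ on V^U with χ² ≠ 1 would give π ≅ I(χ), so a and
a⁻¹ act equally on V^U (`diagMat_apply_eq_inv`). -/

namespace Representation

/-! ### Irreducible representations of a finite group: finiteness and Burnside's theorem -/

section Irreducible

variable {G : Type*} [Group G] {W : Type*} [AddCommGroup W] [Module ℂ W]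

theorem IsIrreducible.nontrivial {σ : Representation ℂ G W} (hσ : σ.IsIrreducible) :
    Nontrivial W := by
  obtain ⟨x, y, hxy⟩ := hσ.toNontrivial
  by_contra h
  rw [not_nontrivial_iff_subsingleton] at h
  refine hxy (SetLike.ext fun w => ?_)
  rw [Subsingleton.elim w 0]
  exact ⟨fun _ => y.toSubmodule.zero_mem, fun _ => x.toSubmodule.zero_mem⟩

/-- An invariant subspace with a nonzero element is everything. -/
theorem IsIrreducible.eq_top_of_invariant {σ : Representation ℂ G W} (hσ : σ.IsIrreducible)
    (S : Submodule ℂ W) (hS : ∀ g, ∀ w ∈ S, σ g w ∈ S) {w : W} (hw : w ∈ S) (hw0 : w ≠ 0) :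
    S = ⊤ := by
  have := hσ
  let T : Subrepresentation σ := ⟨S, fun g w hw => hS g w hw⟩
  rcases eq_bot_or_eq_top T with h | h
  · exfalso
    have h1 : w ∈ T := hw
    rw [h] at h1
    exact hw0 h1
  · have : T.toSubmodule = (⊤ : Subrepresentation σ).toSubmodule := by rw [h]
    exact this

/-- The finite orbit of any nonzero vector spans an invariant subspace. -/
theorem IsIrreducible.finiteDimensional [Finite G] {σ : Representation ℂ G W} (hσ : σ.IsIrreducible) :
    FiniteDimensional ℂ W := by
  have := hσ.nontrivial
  obtain ⟨w, hw⟩ := exists_ne (0 : W)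
  have h := hσ.eq_top_of_invariant (Submodule.span ℂ (Set.range fun g => σ g w)) ?_
    (Submodule.subset_span ⟨1, by simp⟩) hw
  · exact ⟨h ▸ Submodule.fg_span (Set.finite_range _)⟩
  · intro g x hx
    induction hx using Submodule.span_induction with
    | mem x hx =>
      obtain ⟨h, rfl⟩ := hx
      exact Submodule.subset_span ⟨g * h, by simp⟩
    | zero => simp
    | add x y _ _ hx hy => rw [map_add]; exact Submodule.add_mem _ hx hy
    | smul c x _ hx => rw [map_smul]; exact Submodule.smul_mem _ c hx

/-- Burnside's theorem. -/
theorem IsIrreducible.span_range_eq_top [Finite G] {σ : Representation ℂ G W} (hσ : σ.IsIrreducible) :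
    Submodule.span ℂ (Set.range fun g => (σ g : Module.End ℂ W)) = ⊤ := by
  have := hσ
  have := hσ.finiteDimensional
  have hfin : Module.Finite (Module.End (MonoidAlgebra ℂ G) σ.asModule) σ.asModule :=
    Module.Finite.of_restrictScalars_finite ℂ _ _
  refine eq_top_iff.mpr fun f _ => ?_
  -- By Schur the commutant consists of scalars, so every ℂ-linear map is linear over it; the double
  -- commutant theorem then places f in the image of the group algebra.
  let F : Module.End (Module.End (MonoidAlgebra ℂ G) σ.asModule) σ.asModule :=
    { toFun := fun v => f v
      map_add' := fun v w => f.map_add v w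
      map_smul' := fun a v => by
        obtain ⟨c, rfl⟩ := (IsSimpleModule.algebraMap_end_bijective_of_isAlgClosed
          (A := MonoidAlgebra ℂ G) (V := σ.asModule) ℂ).2 a
        exact f.map_smul c v }
  obtain ⟨r, hr⟩ := Module.Finite.toModuleEnd_moduleEnd_surjective
    (R := MonoidAlgebra ℂ G) (M := σ.asModule) F
  have hf : f = σ.asAlgebraHom r := by
    refine LinearMap.ext fun v => ?_
    have := congrArg (fun T => T (σ.asModuleEquiv.symm v)) hr
    exact this.symm
  rw [hf]
  clear hf hr
  induction r using MonoidAlgebra.induction_on with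
  | of g => exact Submodule.subset_span ⟨g, by simp⟩
  | add x y hx hy => rw [map_add]; exact Submodule.add_mem _ hx hy
  | smul c x hx => rw [map_smul]; exact Submodule.smul_mem _ c hx

end Irreducible

/-! ### Averaging over the group, and multiplicity one from commutativity -/

section Average

variable {G : Type*} [Group G] [Fintype G] {V W : Type*} [AddCommGroup V] [Module ℂ V]
  [AddCommGroup W] [Module ℂ W]

/-- The sum of all conjugates of a linear map by the group. -/
noncomputable def conjSum (σ : Representation ℂ G W) (ρ : Representation ℂ G V) :
    (W →ₗ[ℂ] V) →ₗ[ℂ] (W →ₗ[ℂ] V) where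
  toFun X := ∑ g : G, ρ g ∘ₗ X ∘ₗ σ g⁻¹
  map_add' X Y := by
    simp only [LinearMap.add_comp, LinearMap.comp_add, Finset.sum_add_distrib]
  map_smul' c X := by
    simp only [LinearMap.smul_comp, LinearMap.comp_smul, Finset.smul_sum, RingHom.id_apply]

theorem conjSum_apply (σ : Representation ℂ G W) (ρ : Representation ℂ G V) (X : W →ₗ[ℂ] V) :
    conjSum σ ρ X = ∑ g : G, ρ g ∘ₗ X ∘ₗ σ g⁻¹ := rfl

theorem comp_conjSum (σ : Representation ℂ G W) (ρ : Representation ℂ G V) (X : W →ₗ[ℂ] V)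
    (h : G) : ρ h ∘ₗ conjSum σ ρ X = conjSum σ ρ X ∘ₗ σ h := by
  have e : ∀ g, ρ h ∘ₗ ρ g ∘ₗ X ∘ₗ σ g⁻¹ = ρ (h * g) ∘ₗ X ∘ₗ σ (h * g)⁻¹ ∘ₗ σ h := by
    intro g
    refine LinearMap.ext fun v => ?_
    simp [← Module.End.mul_apply, ← map_mul, mul_assoc]
  refine LinearMap.ext fun v => ?_
  simp only [conjSum_apply, LinearMap.comp_apply, LinearMap.sum_apply, map_sum]
  exact Fintype.sum_equiv (Equiv.mulLeft h) _ _ fun g => LinearMap.congr_fun (e g) v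

/-- The sum of all conjugates of a linear map, as an intertwining map. -/
noncomputable def conjSumHom (σ : Representation ℂ G W) (ρ : Representation ℂ G V)
    (X : W →ₗ[ℂ] V) : IntertwiningMap σ ρ where
  toLinearMap := conjSum σ ρ X
  isIntertwining' g := (comp_conjSum σ ρ X g).symm

/-- Maschke's argument: average a linear left inverse. -/
theorem IntertwiningMap.exists_leftInverse {σ : Representation ℂ G W} {ρ : Representation ℂ G V}
    (f : IntertwiningMap σ ρ) (hf : Function.Injective f) :
    ∃ p : IntertwiningMap ρ σ, ∀ w, p (f w) = w := by
  obtain ⟨φ, hφ⟩ := f.toLinearMap.exists_leftInverse_of_injective (LinearMap.ker_eq_bot.mpr hf)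
  have hφ' : ∀ w, φ (f w) = w := fun w => LinearMap.congr_fun hφ w
  refine ⟨(Fintype.card G : ℂ)⁻¹ • conjSumHom ρ σ φ, fun w => ?_⟩
  have h1 : conjSumHom ρ σ φ (f w) = (Fintype.card G : ℂ) • w := by
    change (∑ g : G, σ g ∘ₗ φ ∘ₗ ρ g⁻¹) (f w) = _
    have e : ∀ g : G, (σ g ∘ₗ φ ∘ₗ ρ g⁻¹) (f w) = w := by
      intro g
      rw [LinearMap.comp_apply, LinearMap.comp_apply, ← f.isIntertwining, hφ',
        ← Module.End.mul_apply, ← map_mul, mul_inv_cancel, map_one, Module.End.one_apply]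
    rw [LinearMap.sum_apply, Finset.sum_congr rfl fun g _ => e g, Finset.sum_const,
      Finset.card_univ, Nat.cast_smul_eq_nsmul]
  rw [IntertwiningMap.smul_apply, h1, smul_smul,
    inv_mul_cancel₀ (Nat.cast_ne_zero.mpr Fintype.card_ne_zero), one_smul]

/-- A representation with commutative endomorphism algebra is multiplicity free. -/
theorem isMultiplicityFree_of_commute {ρ : Representation ℂ G V}
    (h : ∀ A B : IntertwiningMap ρ ρ, A * B = B * A) : Representation.IsMultiplicityFree.{w} ρ := by
  intro W _ _ σ hσ
  have := hσ
  have := hσ.finiteDimensional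
  by_cases h0 : ∀ f : IntertwiningMap σ ρ, f = 0
  · have : Subsingleton (IntertwiningMap σ ρ) := ⟨fun f g => (h0 f).trans (h0 g).symm⟩
    rw [rank_subsingleton']
    exact zero_le_one
  · push Not at h0
    obtain ⟨f, hf⟩ := h0
    have hinj := (IsIrreducible.injective_or_eq_zero f).resolve_right hf
    obtain ⟨p, hp⟩ := f.exists_leftInverse hinj
    refine rank_le_one_iff.mpr ⟨f, fun f₂ => ?_⟩
    obtain ⟨c, hc⟩ := (IsIrreducible.algebraMap_intertwiningMap_bijective_of_isAlgClosed
      (ρ := σ)).2 (p.comp f₂)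
    have hc' : ∀ w, p (f₂ w) = c • w := fun w => by
      have := congrArg (fun T : IntertwiningMap σ σ => T w) hc
      exact this.symm
    refine ⟨c, IntertwiningMap.ext (LinearMap.ext fun w => ?_)⟩
    -- By Schur p ∘ f₂ is a scalar c. On f w, (f p)(f₂ p) gives c • f w while (f₂ p)(f p) gives f₂
    -- w, so commutativity forces f₂ = c • f.
    have key := congrArg (fun T : IntertwiningMap ρ ρ => T (f w)) (h (f.comp p) (f₂.comp p))
    simp only [IntertwiningMap.mul_apply, IntertwiningMap.comp_apply, hp] at key
    change c • f w = f₂ w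
    rw [← key, hc', map_smul]

end Average

end Representation

noncomputable section
namespace SLTwo

/-! ### The anti-involution of SL₂ -/

section Flip

variable {k : Type*} [Field k]

/-- The anti-involution of `SL₂(k)` exchanging the two diagonal entries. -/
def flip (g : SL(2, k)) : SL(2, k) :=
  ⟨!![g 1 1, g 0 1; g 1 0, g 0 0], by
    rw [Matrix.det_fin_two_of, mul_comm]; exact det_entries g⟩

@[simp] lemma flip_zero_zero (g : SL(2, k)) : flip g 0 0 = g 1 1 := rfl
@[simp] lemma flip_zero_one (g : SL(2, k)) : flip g 0 1 = g 0 1 := rfl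
@[simp] lemma flip_one_zero (g : SL(2, k)) : flip g 1 0 = g 1 0 := rfl
@[simp] lemma flip_one_one (g : SL(2, k)) : flip g 1 1 = g 0 0 := rfl

lemma ext_entries {g h : SL(2, k)} (h₀₀ : g 0 0 = h 0 0) (h₀₁ : g 0 1 = h 0 1)
    (h₁₀ : g 1 0 = h 1 0) (h₁₁ : g 1 1 = h 1 1) : g = h := by
  ext i j
  fin_cases i <;> fin_cases j <;> assumption

@[simp] lemma flip_flip (g : SL(2, k)) : flip (flip g) = g :=
  ext_entries rfl rfl rfl rfl

lemma flip_mul (g h : SL(2, k)) : flip (g * h) = flip h * flip g := by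
  apply ext_entries <;>
  simp only [flip_zero_zero, flip_zero_one, flip_one_zero, flip_one_one, mul_entries] <;> ring

lemma flip_one : flip (1 : SL(2, k)) = 1 := by
  apply ext_entries <;> simp

lemma flip_inv (g : SL(2, k)) : flip g⁻¹ = (flip g)⁻¹ :=
  eq_inv_of_mul_eq_one_right (by rw [← flip_mul, inv_mul_cancel, flip_one])

/-- `flip`, composed with the inverse, as a permutation of `SL₂(k)`. -/
def flipInv : SL(2, k) ≃ SL(2, k) where
  toFun g := flip g⁻¹
  invFun g := (flip g)⁻¹
  left_inv g := by simp
  right_inv g := by simp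

section Entries

variable (b : k) (a : kˣ)

@[simp] lemma upperMat_zero_zero : upperMat b 0 0 = 1 := rfl
@[simp] lemma upperMat_zero_one : upperMat b 0 1 = b := rfl
@[simp] lemma upperMat_one_zero : upperMat b 1 0 = 0 := rfl
@[simp] lemma upperMat_one_one : upperMat b 1 1 = 1 := rfl
@[simp] lemma diagMat_zero_zero : diagMat a 0 0 = a := rfl
@[simp] lemma diagMat_zero_one : diagMat a 0 1 = 0 := rfl
@[simp] lemma diagMat_one_zero : diagMat a 1 0 = 0 := rfl
@[simp] lemma diagMat_one_one : diagMat a 1 1 = (a : k)⁻¹ := rfl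
@[simp] lemma weylMat_zero_zero : weylMat a 0 0 = 0 := rfl
@[simp] lemma weylMat_zero_one : weylMat a 0 1 = a := rfl
@[simp] lemma weylMat_one_zero : weylMat a 1 0 = -(a : k)⁻¹ := rfl
@[simp] lemma weylMat_one_one : weylMat a 1 1 = 0 := rfl

end Entries

lemma inv_entries (g : SL(2, k)) :
    g⁻¹ 0 0 = g 1 1 ∧ g⁻¹ 0 1 = -g 0 1 ∧ g⁻¹ 1 0 = -g 1 0 ∧ g⁻¹ 1 1 = g 0 0 := by
  simp [Matrix.SpecialLinearGroup.coe_inv, Matrix.adjugate_fin_two]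

lemma upperMat_zero : upperMat (0 : k) = 1 := by
  apply ext_entries <;> simp

lemma upperMat_mul (x y : k) : upperMat x * upperMat y = upperMat (x + y) := by
  apply ext_entries <;> rw [mul_entries] <;> simp [add_comm]

lemma upperMat_inv (x : k) : (upperMat x)⁻¹ = upperMat (-x) :=
  inv_eq_of_mul_eq_one_right (by rw [upperMat_mul, add_neg_cancel, upperMat_zero])

/-- Conjugating by u(t) adds t · h₁₀ to the upper left entry and subtracts it from the lower right
one; this t exchanges the two, and the determinant fixes the remaining entry. -/
lemma flip_eq_conj_of_ne {h : SL(2, k)} (hc : h 1 0 ≠ 0) :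
    flip h = upperMat ((h 1 1 - h 0 0) / h 1 0) * h * upperMat (-((h 1 1 - h 0 0) / h 1 0)) := by
  have hd := det_entries h
  apply ext_entries <;> simp only [mul_entries, upperMat_zero_zero, upperMat_zero_one,
    upperMat_one_zero, upperMat_one_one, flip_zero_zero, flip_zero_one, flip_one_zero,
    flip_one_one] <;> field_simp <;> ring

end Flip

/-! ### Weil operators as matrices -/

section WeilMatrix

variable {k : Type*} [Field k] [Fintype k] [DecidableEq k]

/-- The matrix of the Weil operator of `g`. -/
def weilMatrix (ψ : AddChar k ℂ) (g : SL(2, k)) : Matrix k k ℂ := (weilOp ψ g).toMatrix'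

lemma toLin'_weilMatrix (ψ : AddChar k ℂ) (g : SL(2, k)) :
    Matrix.toLin' (weilMatrix ψ g) = weilOp ψ g := Matrix.toLin'_toMatrix' _

lemma weilMatrix_of_ne (ψ : AddChar k ℂ) {g : SL(2, k)} (h : g 1 0 ≠ 0) (ξ x : k) :
    weilMatrix ψ g ξ x = (gam ψ (-(g 1 0)⁻¹))⁻¹ *
      ψ ((g 0 0 * ξ ^ 2 - 2 * x * ξ + g 1 1 * x ^ 2) / g 1 0) := by
  rw [weilMatrix, LinearMap.toMatrix'_apply, weilOp_apply_of_ne ψ h]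
  simp [Pi.single_apply]

lemma weilMatrix_of_eq (ψ : AddChar k ℂ) {g : SL(2, k)} (h : g 1 0 = 0) (ξ x : k) :
    weilMatrix ψ g ξ x =
      if g 0 0 * ξ = x then eps (g 0 0) * ψ (g 0 0 * g 0 1 * ξ ^ 2) else 0 := by
  rw [weilMatrix, LinearMap.toMatrix'_apply, weilOp_apply_of_eq ψ h]
  simp [Pi.single_apply]

lemma weilMatrix_upperMat (ψ : AddChar k ℂ) (b : k) :
    weilMatrix ψ (upperMat b) = Matrix.diagonal fun ξ => ψ (b * ξ ^ 2) := by
  ext ξ x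
  rw [weilMatrix_of_eq ψ (by simp [upperMat]), Matrix.diagonal_apply]
  simp [upperMat, eps_one]

/-- The kernel is symmetric under exchanging its two variables together with the two diagonal
entries of g; in the triangular case this also uses ε(a⁻¹) = ε(a). It makes transposition the
counterpart of `flip` on the Weil side. -/
lemma weilMatrix_flip (ψ : AddChar k ℂ) (g : SL(2, k)) :
    weilMatrix ψ (flip g) = (weilMatrix ψ g).transpose := by
  ext ξ x
  rw [Matrix.transpose_apply]
  by_cases h : g 1 0 = 0
  · rw [weilMatrix_of_eq ψ (g := flip g) h, weilMatrix_of_eq ψ h]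
    have hd := det_entries g
    rw [h, mul_zero, sub_zero] at hd
    have ha : g 0 0 ≠ 0 := left_ne_zero_of_mul_eq_one hd
    have e : g 1 1 = (g 0 0)⁻¹ := eq_inv_of_mul_eq_one_right hd
    simp only [flip_zero_zero, flip_zero_one]
    have hiff : g 1 1 * ξ = x ↔ g 0 0 * x = ξ := by
      rw [e, inv_mul_eq_iff_eq_mul₀ ha, eq_comm]
    simp only [hiff]
    split_ifs with hx
    · rw [e, eps_inv ha, ← hx]
      congr 2
      field_simp
    · rfl
  · rw [weilMatrix_of_ne ψ (g := flip g) h, weilMatrix_of_ne ψ h]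
    simp only [flip_zero_zero, flip_one_one, flip_one_zero]
    congr 3
    ring

variable (hk : ringChar k ≠ 2) {ψ : AddChar k ℂ} (hψ : ψ ≠ 1)

include hk hψ

/-- The product of the Weil matrix of `u(b)w` with a diagonal matrix unit and its inverse. -/
lemma weilMatrix_conj_single (b ξ : k) :
    weilMatrix ψ (upperMat b * weylMat 1) * Matrix.single ξ ξ 1 *
      weilMatrix ψ (upperMat b * weylMat 1)⁻¹ =
    (Fintype.card k : ℂ)⁻¹ • Matrix.of fun x y => ψ (b * (x ^ 2 - y ^ 2) + ξ * (2 * (x - y))) := by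
  set g := upperMat b * weylMat (1 : kˣ) with hg
  have e00 : g 0 0 = -b := by rw [hg, mul_entries]; simp
  have e01 : g 0 1 = 1 := by rw [hg, mul_entries]; simp
  have e10 : g 1 0 = -1 := by rw [hg, mul_entries]; simp
  have e11 : g 1 1 = 0 := by rw [hg, mul_entries]; simp
  have f00 : g⁻¹ 0 0 = 0 := by simp [inv_entries, e11]
  have f10 : g⁻¹ 1 0 = 1 := by simp [inv_entries, e10]
  have f11 : g⁻¹ 1 1 = -b := by simp [inv_entries, e00]
  ext x y
  have h1 : (weilMatrix ψ g * Matrix.single ξ ξ (1 : ℂ) * weilMatrix ψ g⁻¹ : Matrix k k ℂ) x y =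
      weilMatrix ψ g x ξ * weilMatrix ψ g⁻¹ ξ y := by
    rw [Matrix.mul_apply, Finset.sum_eq_single ξ]
    · simp
    · intro z _ hz
      rw [Matrix.mul_single_apply_of_ne (hbj := hz), zero_mul]
    · simp
  -- The lower left entries -1 and 1 of g and g⁻¹ contribute γ(1)⁻¹ γ(-1)⁻¹ = |k|⁻¹.
  rw [h1, weilMatrix_of_ne ψ (by rw [e10]; simp), weilMatrix_of_ne ψ (by rw [f10]; simp),
    e00, e10, e11, f00, f10, f11, Matrix.smul_apply, Matrix.of_apply, smul_eq_mul,
    ← gam_one_mul_gam_neg_one hk hψ, mul_inv, mul_mul_mul_comm, ← AddChar.map_add_eq_mul]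
  congr 2
  · simp
  · rw [inv_one]
  · rw [div_neg, div_one, div_one]; ring

/-- The conjugates of the diagonal matrices by the Weil representation span all matrices. -/
lemma mem_of_weilMatrix_conj (S : Submodule ℂ (Matrix k k ℂ))
    (hS : ∀ (g : SL(2, k)) (d : k → ℂ),
      weilMatrix ψ g * Matrix.diagonal d * weilMatrix ψ g⁻¹ ∈ S) (M : Matrix k k ℂ) : M ∈ S := by
  have h2 : (2 : k) ≠ 0 := Ring.two_ne_zero hk
  have hprim := AddChar.IsPrimitive.of_ne_one hψ
  suffices h : ∀ x y : k, Matrix.single x y (1 : ℂ) ∈ S by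
    rw [Matrix.matrix_eq_sum_single M]
    refine Submodule.sum_mem _ fun x _ => Submodule.sum_mem _ fun y _ => ?_
    rw [← mul_one (M x y), ← smul_eq_mul, ← Matrix.smul_single]
    exact Submodule.smul_mem _ _ (h x y)
  intro x₀ y₀
  by_cases hxy : x₀ = y₀
  · subst hxy
    have := hS 1 (Pi.single x₀ 1)
    have h1 : weilMatrix ψ (1 : SL(2, k)) = 1 := by
      rw [weilMatrix, weilOp_one, Module.End.one_eq_id, LinearMap.toMatrix'_id]
    rwa [inv_one, h1, one_mul, mul_one, Matrix.diagonal_single] at this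
  -- Fourier inversion on k × k in the variables (b, ξ): off the diagonal, the pair (x² - y², x - y)
  -- determines (x, y). One factor |k|⁻¹ stands outside, the other comes from
  -- `weilMatrix_conj_single`.
  · have key : Matrix.single x₀ y₀ (1 : ℂ) = (Fintype.card k : ℂ)⁻¹ •
        ∑ b : k, ∑ ξ : k, ψ (-(b * (x₀ ^ 2 - y₀ ^ 2) + ξ * (2 * (x₀ - y₀)))) •
          (weilMatrix ψ (upperMat b * weylMat 1) * Matrix.diagonal (Pi.single ξ 1) *
            weilMatrix ψ (upperMat b * weylMat 1)⁻¹) := by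
      ext x y
      simp only [Matrix.diagonal_single, weilMatrix_conj_single hk hψ, Matrix.smul_apply,
        Matrix.sum_apply, Matrix.of_apply, smul_eq_mul]
      have e : ∀ b ξ : k, ψ (-(b * (x₀ ^ 2 - y₀ ^ 2) + ξ * (2 * (x₀ - y₀)))) *
          ((Fintype.card k : ℂ)⁻¹ * ψ (b * (x ^ 2 - y ^ 2) + ξ * (2 * (x - y)))) =
          (Fintype.card k : ℂ)⁻¹ * (ψ (b * ((x ^ 2 - y ^ 2) - (x₀ ^ 2 - y₀ ^ 2))) *
            ψ (ξ * (2 * ((x - y) - (x₀ - y₀))))) := by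
        intro b ξ
        rw [mul_left_comm, ← AddChar.map_add_eq_mul, ← AddChar.map_add_eq_mul]
        congr 2
        ring
      simp only [e, ← Finset.mul_sum, ← Finset.sum_mul, AddChar.sum_mulShift _ hprim]
      rw [Matrix.single_apply]
      have hcard := card_ne_zero (k := k)
      by_cases hc : x₀ = x ∧ y₀ = y
      · obtain ⟨rfl, rfl⟩ := hc
        simp
      · rw [if_neg hc]
        by_cases h3 : 2 * ((x - y) - (x₀ - y₀)) = 0
        · have h4 : x - y = x₀ - y₀ := sub_eq_zero.mp ((mul_eq_zero.mp h3).resolve_left h2)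
          -- As x - y = x₀ - y₀ is nonzero, equal differences of squares would give x + y = x₀ + y₀,
          -- hence (x, y) = (x₀, y₀) in odd characteristic.
          have h5 : (x ^ 2 - y ^ 2) - (x₀ ^ 2 - y₀ ^ 2) ≠ 0 := by
            intro h5
            have h6 : (x₀ - y₀) * (x + y - (x₀ + y₀)) = 0 := by
              linear_combination h5 - (x + y) * h4
            have h7 := (mul_eq_zero.mp h6).resolve_left (sub_ne_zero.mpr hxy)
            refine hc ⟨mul_left_cancel₀ h2 ?_, mul_left_cancel₀ h2 ?_⟩
            · linear_combination -h7 - h4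
            · linear_combination -h7 + h4
          simp [h5]
        · simp [h3]
    rw [key]
    exact Submodule.smul_mem _ _ (Submodule.sum_mem _ fun b _ => Submodule.sum_mem _ fun ξ _ =>
      Submodule.smul_mem _ _ (hS _ _))

end WeilMatrix

/-! ### Relations in the Borel subgroup -/

section Borel

variable {k : Type*} [Field k]

lemma upperMat_mem_borel (x : k) : upperMat x ∈ borel k := by
  change upperMat x 1 0 = 0
  simp

lemma diagMat_mem_borel (a : kˣ) : diagMat a ∈ borel k := by
  change diagMat a 1 0 = 0
  simp

@[simp] lemma borelDiag_upperMat (x : k) (h) : borelDiag k ⟨upperMat x, h⟩ = 1 := Units.ext rfl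

@[simp] lemma borelDiag_diagMat (a : kˣ) (h) : borelDiag k ⟨diagMat a, h⟩ = a := Units.ext rfl

lemma eq_upperMat_mul_diagMat {g : SL(2, k)} (hg : g ∈ borel k) :
    g = upperMat (g 0 0 * g 0 1) * diagMat (borelDiag k ⟨g, hg⟩) := by
  have hd := borel_det ⟨g, hg⟩
  have ha : g 0 0 ≠ 0 := left_ne_zero_of_mul_eq_one hd
  have h0 : g 1 0 = 0 := hg
  have e : ((borelDiag k ⟨g, hg⟩ : kˣ) : k) = g 0 0 := rfl
  apply ext_entries <;> rw [mul_entries] <;> simp only [upperMat_zero_zero, upperMat_zero_one,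
    upperMat_one_zero, upperMat_one_one, diagMat_zero_zero, diagMat_zero_one, diagMat_one_zero,
    diagMat_one_one, e, h0]
  · ring
  · field_simp
    ring
  · ring
  · rw [zero_mul, zero_add, one_mul]
    exact eq_inv_of_mul_eq_one_right hd

lemma upperMat_mul_diagMat (x : k) (a : kˣ) :
    upperMat x * diagMat a = diagMat a * upperMat ((a : k)⁻¹ * (a : k)⁻¹ * x) := by
  have ha := a.ne_zero
  apply ext_entries <;> simp only [mul_entries, upperMat_zero_zero, upperMat_zero_one,
    upperMat_one_zero, upperMat_one_one, diagMat_zero_zero, diagMat_zero_one, diagMat_one_zero,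
    diagMat_one_one] <;> field_simp <;> ring

lemma diagMat_mul (a b : kˣ) : diagMat (a * b) = diagMat a * diagMat b := by
  apply ext_entries <;> rw [mul_entries] <;> simp [mul_comm]

lemma diagMat_one : diagMat (1 : kˣ) = 1 := by
  apply ext_entries <;> simp

lemma weylMat_mul_diagMat (a : kˣ) : weylMat 1 * diagMat a = diagMat a⁻¹ * weylMat 1 := by
  apply ext_entries <;> rw [mul_entries, mul_entries] <;> simp

end Borel

/-! ### Principal series: irreducibility and Frobenius reciprocity -/

section PrincipalSeries

variable {k : Type*} [Field k] (χ : kˣ →* ℂˣ)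

lemma principalSeries_apply
    (f : Representation.coindV (borel k).subtype (borelRep χ)) (g x : SL(2, k)) :
    (principalSeries χ g f).1 x = f.1 (x * g) := rfl

lemma coindV_apply_mul
    (f : Representation.coindV (borel k).subtype (borelRep χ)) (b : borel k) (x : SL(2, k)) :
    f.1 (b * x) = χ (borelDiag k b) * f.1 x := f.2 b x

/-- The character `χ` of the Borel subgroup, extended by zero to `SL₂(k)`. -/
def borelVal [DecidableEq k] (g : SL(2, k)) : ℂ :=
  if h : g 1 0 = 0 then (χ (borelDiag k ⟨g, h⟩) : ℂˣ).1 else 0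

lemma borelVal_of_eq [DecidableEq k] {g : SL(2, k)} (h : g 1 0 = 0) :
    borelVal χ g = (χ (borelDiag k ⟨g, h⟩) : ℂˣ).1 := dif_pos h

lemma borelVal_of_ne [DecidableEq k] {g : SL(2, k)} (h : g 1 0 ≠ 0) :
    borelVal χ g = 0 := dif_neg h

/-- The element of `I(χ)` supported on the Borel subgroup with value `1` at `1`. -/
def borelFun [DecidableEq k] : Representation.coindV (borel k).subtype (borelRep χ) :=
  ⟨borelVal χ, by
    intro b g
    change borelVal χ (b * g) = ((χ (borelDiag k b) : ℂˣ) : ℂ) * borelVal χ g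
    have h0 : (b : SL(2, k)) 1 0 = 0 := b.2
    have h1 : ((b : SL(2, k)) * g) 1 0 = (b : SL(2, k)) 1 1 * g 1 0 := by
      rw [mul_entries, h0, zero_mul, zero_add]
    have h2 : (b : SL(2, k)) 1 1 ≠ 0 := right_ne_zero_of_mul_eq_one (borel_det b)
    by_cases hg : g 1 0 = 0
    · rw [borelVal_of_eq χ hg, borelVal_of_eq χ (g := b * g) (by rw [h1, hg, mul_zero]),
        ← Units.val_mul, ← map_mul, ← map_mul]
      rfl
    · rw [borelVal_of_ne χ hg, borelVal_of_ne χ (g := b * g) (by rw [h1]; exact mul_ne_zero h2 hg),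
        mul_zero]⟩

variable [Fintype k] [DecidableEq k]

/-- Shows that `borelFun` generates I(χ): any f is recovered from the translates of `borelFun`, each
element of the Borel subgroup contributing one copy of f. -/
lemma sum_borelFun (f : Representation.coindV (borel k).subtype (borelRep χ)) :
    ∑ g : SL(2, k), f.1 g • principalSeries χ g⁻¹ (borelFun χ) =
      ((Finset.univ.filter fun g : SL(2, k) => g 1 0 = 0).card : ℂ) • f := by
  refine Subtype.ext (funext fun x => ?_)
  rw [Submodule.coe_sum, Finset.sum_apply]
  have e : ∀ h : SL(2, k), f.1 (h⁻¹ * x) * (borelFun χ).1 h = if h 1 0 = 0 then f.1 x else 0 := by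
    intro h
    by_cases hh : h 1 0 = 0
    · let b : borel k := ⟨h, hh⟩
      have h1 := coindV_apply_mul χ f b⁻¹ x
      rw [map_inv, map_inv] at h1
      change f.1 (h⁻¹ * x) = _ at h1
      rw [h1, if_pos hh]
      change _ * borelVal χ h = _
      rw [borelVal_of_eq χ hh, mul_right_comm, Units.inv_mul, one_mul]
    · rw [if_neg hh]
      change _ * borelVal χ h = _
      rw [borelVal_of_ne χ hh, mul_zero]
  have e2 : ∑ g : SL(2, k), (f.1 g • principalSeries χ g⁻¹ (borelFun χ)).1 x =
      ∑ h : SL(2, k), f.1 (h⁻¹ * x) * (borelFun χ).1 h := by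
    refine Fintype.sum_equiv ((Equiv.inv _).trans (Equiv.mulLeft x)) _ _ fun g => ?_
    change f.1 g * (borelFun χ).1 (x * g⁻¹) = f.1 ((x * g⁻¹)⁻¹ * x) * (borelFun χ).1 (x * g⁻¹)
    congr 2
    group
  refine e2.trans ?_
  rw [Finset.sum_congr rfl fun h _ => e h, ← Finset.sum_filter, Finset.sum_const, nsmul_eq_mul]
  rfl

variable {χ}

/-- A vector of `I(χ)` on which the Borel subgroup acts by `χ`, with `χ² ≠ 1`, is supported on
the Borel subgroup. -/
lemma eq_smul_borelFun (hχ : χ ^ 2 ≠ 1)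
    (f : Representation.coindV (borel k).subtype (borelRep χ))
    (hf : ∀ (b : borel k) (x : SL(2, k)), f.1 (x * b) = χ (borelDiag k b) * f.1 x) :
    f = f.1 1 • borelFun χ := by
  obtain ⟨a, ha⟩ : ∃ a, χ a ≠ χ a⁻¹ := by
    by_contra! h
    refine hχ (MonoidHom.ext fun a => ?_)
    rw [MonoidHom.pow_apply, sq, MonoidHom.one_apply]
    nth_rw 1 [h a]
    rw [← map_mul, inv_mul_cancel, map_one]
  -- w diag(a) = diag(a⁻¹) w, so f(w) is multiplied both by χ(a) and by χ(a⁻¹).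
  have hw : f.1 (weylMat 1) = 0 := by
    have h1 := hf ⟨_, diagMat_mem_borel a⟩ (weylMat 1)
    have h2 := coindV_apply_mul χ f ⟨_, diagMat_mem_borel a⁻¹⟩ (weylMat 1)
    simp only [borelDiag_diagMat, weylMat_mul_diagMat] at h1 h2
    have h3 : ((χ a : ℂˣ) - (χ a⁻¹ : ℂˣ) : ℂ) * f.1 (weylMat 1) = 0 := by
      rw [sub_mul, ← h1, ← h2, sub_self]
    refine (mul_eq_zero.mp h3).resolve_left fun h => ha (Units.ext (sub_eq_zero.mp h))
  refine Subtype.ext (funext fun x => ?_)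
  change f.1 x = f.1 1 * borelVal χ x
  by_cases hx : x 1 0 = 0
  · have := hf ⟨x, hx⟩ 1
    rw [one_mul] at this
    rw [borelVal_of_eq χ hx, mul_comm]
    exact this
  · rw [borelVal_of_ne χ hx, mul_zero]
    rcases exists_bruhat x with ⟨a, b, rfl⟩ | ⟨a, b, c, rfl⟩
    · refine absurd ?_ hx
      rw [mul_entries]
      simp
    · have h1 := coindV_apply_mul χ f ⟨_, upperMat_mem_borel b⟩
        (diagMat a * (weylMat 1 * upperMat c))
      have h2 := coindV_apply_mul χ f ⟨_, diagMat_mem_borel a⟩ (weylMat 1 * upperMat c)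
      have h3 := hf ⟨_, upperMat_mem_borel c⟩ (weylMat 1)
      rw [h1, h2, h3, hw, mul_zero, mul_zero, mul_zero]

variable {V : Type*} [AddCommGroup V] [Module ℂ V] {π : Representation ℂ SL(2, k) V}

/-- `I(χ)` is irreducible for `χ² ≠ 1`. -/
lemma surjective_of_ne_zero (hχ : χ ^ 2 ≠ 1)
    (F : Representation.IntertwiningMap π (principalSeries χ)) (hF : F ≠ 0) :
    Function.Surjective F := by
  classical
  obtain ⟨v, hv⟩ : ∃ v, (F v).1 1 ≠ 0 := by
    by_contra! h
    refine hF (Representation.IntertwiningMap.ext (LinearMap.ext fun v =>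
      Subtype.ext (funext fun g => ?_)))
    have h1 := h (π g v)
    rw [F.isIntertwining, principalSeries_apply, one_mul] at h1
    exact h1
  have : Fintype (borel k) := Fintype.ofFinite _
  -- Projection of v to the χ-eigenspace of the Borel subgroup, up to a scalar. Its image is then a
  -- nonzero multiple of the generator `borelFun χ`.
  let v' : V := ∑ b : borel k, ((χ (borelDiag k b))⁻¹ : ℂˣ).1 • π b v
  have hv' : ∀ x, (F v').1 x =
      ∑ b : borel k, ((χ (borelDiag k b))⁻¹ : ℂˣ).1 * (F v).1 (x * b) := by
    intro x
    change (F (∑ b : borel k, ((χ (borelDiag k b))⁻¹ : ℂˣ).1 • π b v)).1 x = _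
    rw [map_sum, Submodule.coe_sum, Finset.sum_apply]
    refine Finset.sum_congr rfl fun b _ => ?_
    rw [map_smul, F.isIntertwining]
    rfl
  have h1 : (F v').1 1 = (Fintype.card (borel k) : ℂ) * (F v).1 1 := by
    have e : ∀ b : borel k,
        ((χ (borelDiag k b))⁻¹ : ℂˣ).1 * (F v).1 (1 * b) = (F v).1 1 := by
      intro b
      have := coindV_apply_mul χ (F v) b 1
      rw [mul_one] at this
      rw [one_mul, this, ← mul_assoc, Units.inv_mul, one_mul]
    rw [hv', Finset.sum_congr rfl fun b _ => e b, Finset.sum_const, Finset.card_univ,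
      nsmul_eq_mul]
  have h2 := eq_smul_borelFun hχ (F v') fun b x => by
    rw [hv', hv', Finset.mul_sum]
    refine Fintype.sum_equiv (Equiv.mulLeft b) _ _ fun c => ?_
    rw [Equiv.coe_mulLeft, map_mul, map_mul, mul_inv, Units.val_mul, ← mul_assoc, ← mul_assoc,
      Units.mul_inv, one_mul, Subgroup.coe_mul, mul_assoc]
  have h3 : (F v').1 1 ≠ 0 := by
    rw [h1]
    exact mul_ne_zero (Nat.cast_ne_zero.mpr Fintype.card_ne_zero) hv
  have h4 : borelFun χ ∈ LinearMap.range F.toLinearMap := by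
    refine ⟨((F v').1 1)⁻¹ • v', ?_⟩
    rw [map_smul]
    change ((F v').1 1)⁻¹ • F v' = _
    nth_rw 2 [h2]
    rw [smul_smul, inv_mul_cancel₀ h3, one_smul]
  have h5 : ∀ f, f ∈ LinearMap.range F.toLinearMap := by
    intro f
    have hcard : ((Finset.univ.filter fun g : SL(2, k) => g 1 0 = 0).card : ℂ) ≠ 0 := by
      rw [Nat.cast_ne_zero]
      exact Finset.card_ne_zero.mpr ⟨1, by simp⟩
    rw [← one_smul ℂ f, ← inv_mul_cancel₀ hcard, ← smul_smul, ← sum_borelFun]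
    refine Submodule.smul_mem _ _ (Submodule.sum_mem _ fun g _ => Submodule.smul_mem _ _ ?_)
    obtain ⟨w, hw⟩ := h4
    exact ⟨π g⁻¹ w, by rw [← hw]; exact F.isIntertwining _ _ g⁻¹ w⟩
  exact h5

omit [DecidableEq k] in
/-- Frobenius reciprocity for a vector on which the Borel subgroup acts by `χ`. -/
lemma exists_intertwiningMap_ne_zero {v₀ : V} (hv₀ : v₀ ≠ 0)
    (h : ∀ b : borel k, π b v₀ = (χ (borelDiag k b) : ℂˣ).1 • v₀) :
    ∃ F : Representation.IntertwiningMap π (principalSeries χ), F ≠ 0 := by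
  classical
  have : Fintype (borel k) := Fintype.ofFinite _
  obtain ⟨l, hl⟩ : ∃ l : Module.Dual ℂ V, l v₀ ≠ 0 := by
    by_contra! h
    exact hv₀ ((Module.forall_dual_apply_eq_zero_iff ℂ v₀).mp h)
  -- Projecting l to the χ-equivariant functionals keeps it nonzero, since at v₀ every summand
  -- equals l v₀. The intertwiner is then v ↦ (g ↦ L(π(g) v)).
  let L : Module.Dual ℂ V := ∑ b : borel k, ((χ (borelDiag k b))⁻¹ : ℂˣ).1 • (l ∘ₗ π b)
  have hL : ∀ v, L v = ∑ b : borel k, ((χ (borelDiag k b))⁻¹ : ℂˣ).1 * l (π b v) := by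
    intro v
    simp only [L, LinearMap.sum_apply, LinearMap.smul_apply, LinearMap.comp_apply, smul_eq_mul]
  have hL₀ : L v₀ ≠ 0 := by
    have e : ∀ b : borel k, ((χ (borelDiag k b))⁻¹ : ℂˣ).1 * l (π b v₀) = l v₀ := by
      intro b
      rw [h, map_smul, smul_eq_mul, ← mul_assoc, Units.inv_mul, one_mul]
    rw [hL, Finset.sum_congr rfl fun b _ => e b, Finset.sum_const, Finset.card_univ, nsmul_eq_mul]
    exact mul_ne_zero (Nat.cast_ne_zero.mpr Fintype.card_ne_zero) hl
  have hLb : ∀ (b : borel k) (v : V), L (π b v) = (χ (borelDiag k b) : ℂˣ).1 * L v := by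
    intro b v
    rw [hL, hL, Finset.mul_sum]
    refine Fintype.sum_equiv (Equiv.mulRight b) _ _ fun c => ?_
    rw [Equiv.coe_mulRight, map_mul, map_mul, mul_comm (χ _) (χ _), mul_inv, Units.val_mul, ← mul_assoc,
      ← mul_assoc, Units.mul_inv, one_mul, Subgroup.coe_mul, map_mul, Module.End.mul_apply]
  let F : V →ₗ[ℂ] Representation.coindV (borel k).subtype (borelRep χ) :=
    { toFun := fun v => ⟨fun g => L (π g v), fun b g => by
        change L (π (b * g) v) = (χ (borelDiag k b) : ℂˣ).1 * L (π g v)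
        rw [map_mul, Module.End.mul_apply, hLb]⟩
      map_add' := fun v w => Subtype.ext (funext fun g => by simp)
      map_smul' := fun c v => Subtype.ext (funext fun g => by simp) }
  refine ⟨⟨F, fun g => LinearMap.ext fun v => Subtype.ext (funext fun x => ?_)⟩, fun h0 => hL₀ ?_⟩
  · change L (π x (π g v)) = L (π (x * g) v)
    rw [map_mul, Module.End.mul_apply]
  · have h1 := congrArg (fun T : Representation.IntertwiningMap π (principalSeries χ) =>
      (T v₀).1 1) h0
    change L (π 1 v₀) = 0 at h1
    rwa [map_one, Module.End.one_apply] at h1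

end PrincipalSeries

/-! ### The torus on unipotent invariants -/

section TorusAction

variable {k : Type*} [Field k] [Fintype k] [DecidableEq k]

omit [DecidableEq k] in
-- Orthogonality of characters: multiplying by some η with η(t⁻¹) ≠ 1 permutes the sum and scales
-- it.
lemma sum_unitHom [Fintype (kˣ →* ℂˣ)] {t : kˣ} (ht : t ≠ 1) :
    ∑ χ : kˣ →* ℂˣ, ((χ t)⁻¹ : ℂˣ).1 = 0 := by
  obtain ⟨η, hη⟩ := CommGroup.exists_apply_ne_one_of_hasEnoughRootsOfUnity kˣ ℂ
    (inv_ne_one.mpr ht)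
  have h : ((η t)⁻¹ : ℂˣ).1 * ∑ χ : kˣ →* ℂˣ, ((χ t)⁻¹ : ℂˣ).1 =
      ∑ χ : kˣ →* ℂˣ, ((χ t)⁻¹ : ℂˣ).1 := by
    rw [Finset.mul_sum]
    refine Fintype.sum_equiv (Equiv.mulLeft η) _ _ fun χ => ?_
    rw [Equiv.coe_mulLeft, MonoidHom.mul_apply, mul_inv, Units.val_mul]
  by_contra h0
  refine hη (Units.ext ?_)
  rw [map_inv]
  exact mul_right_cancel₀ h0 (h.trans (one_mul _).symm)

variable {V : Type*} [AddCommGroup V] [Module ℂ V] {π : Representation ℂ SL(2, k) V}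

/-- The projection to a torus eigenspace, up to a scalar. -/
def torusSum (π : Representation ℂ SL(2, k) V) (χ : kˣ →* ℂˣ) (v : V) : V :=
  ∑ t : kˣ, ((χ t)⁻¹ : ℂˣ).1 • π (diagMat t) v

lemma torusSum_diagMat (χ : kˣ →* ℂˣ) (a : kˣ) (v : V) :
    torusSum π χ (π (diagMat a) v) = (χ a).1 • torusSum π χ v := by
  rw [torusSum, torusSum, Finset.smul_sum]
  refine Fintype.sum_equiv (Equiv.mulLeft a) _ _ fun t => ?_
  rw [show Equiv.mulLeft a t = t * a from mul_comm a t, smul_smul, ← Units.val_mul, map_mul,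
    mul_inv_rev, mul_inv_cancel_left, diagMat_mul, map_mul, Module.End.mul_apply]

lemma diagMat_torusSum (χ : kˣ →* ℂˣ) (a : kˣ) (v : V) :
    π (diagMat a) (torusSum π χ v) = (χ a).1 • torusSum π χ v := by
  rw [← torusSum_diagMat, torusSum, torusSum, map_sum]
  refine Finset.sum_congr rfl fun t _ => ?_
  rw [map_smul, ← Module.End.mul_apply, ← Module.End.mul_apply, ← map_mul, ← map_mul,
    ← diagMat_mul, ← diagMat_mul, mul_comm]

/-- Summed over all χ, the projections retain only the term t = 1, a nonzero multiple of v. -/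
lemma eq_zero_of_torusSum {v : V} (h : ∀ χ, torusSum π χ v = 0) : v = 0 := by
  have : Fintype (kˣ →* ℂˣ) := Fintype.ofFinite _
  have h1 : ∑ χ : kˣ →* ℂˣ, torusSum π χ v = (Fintype.card (kˣ →* ℂˣ) : ℂ) • v := by
    simp only [torusSum]
    rw [Finset.sum_comm, Finset.sum_eq_single 1]
    · simp [diagMat_one, ← Nat.cast_smul_eq_nsmul ℂ]
    · intro t _ ht
      rw [← Finset.sum_smul, sum_unitHom ht, zero_smul]
    · simp
  rw [Finset.sum_eq_zero fun χ _ => h χ] at h1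
  exact (smul_eq_zero.mp h1.symm).resolve_left (Nat.cast_ne_zero.mpr Fintype.card_ne_zero)

/-- If `π` is not an irreducible principal series representation, the squares in the torus act
trivially on the unipotent invariants. -/
lemma diagMat_apply_eq_inv (hirr : π.IsIrreducible)
    (hπ : ∀ χ : kˣ →* ℂˣ, χ ^ 2 ≠ 1 → ¬ Nonempty (π.Equiv (principalSeries χ)))
    {v : V} (hv : ∀ x, π (upperMat x) v = v) (a : kˣ) :
    π (diagMat a) v = π (diagMat a⁻¹) v := by
  have := hirr
  rw [← sub_eq_zero]
  refine eq_zero_of_torusSum (π := π) fun χ => ?_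
  have h1 : torusSum π χ (π (diagMat a) v - π (diagMat a⁻¹) v) =
      ((χ a).1 - (χ a⁻¹).1) • torusSum π χ v := by
    rw [sub_smul, ← torusSum_diagMat, ← torusSum_diagMat]
    simp only [torusSum, map_sub, smul_sub, Finset.sum_sub_distrib]
  rw [h1]
  by_cases hχ : χ ^ 2 = 1
  · have h2 : χ a = χ a⁻¹ := by
      have := DFunLike.congr_fun hχ a
      rw [MonoidHom.pow_apply, sq, MonoidHom.one_apply] at this
      rw [map_inv]
      exact eq_inv_of_mul_eq_one_left this
    rw [h2, sub_self, zero_smul]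
  · have h2 : torusSum π χ v = 0 := by
      by_contra h0
      obtain ⟨F, hF⟩ := exists_intertwiningMap_ne_zero (π := π) (χ := χ) h0 fun b => by
        -- The torus normalizes the unipotent group, so the projection preserves its invariants.
        have hu : ∀ x, π (upperMat x) (torusSum π χ v) = torusSum π χ v := by
          intro x
          rw [torusSum, map_sum]
          refine Finset.sum_congr rfl fun t _ => ?_
          rw [map_smul, ← Module.End.mul_apply, ← map_mul, upperMat_mul_diagMat, map_mul,
            Module.End.mul_apply, hv]
        have hb := eq_upperMat_mul_diagMat b.2
        nth_rw 1 [hb]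
        rw [map_mul, Module.End.mul_apply, diagMat_torusSum, map_smul, hu]
      exact hπ χ hχ ⟨F.ofBijective
        ⟨(Representation.IsIrreducible.injective_or_eq_zero F).resolve_right hF,
          surjective_of_ne_zero hχ F hF⟩⟩
    rw [h2, smul_zero]

/-- Under the same hypothesis, summing over unipotent conjugates does not distinguish `h` from
`flip h`. -/
lemma sum_conj_flip (hirr : π.IsIrreducible)
    (hπ : ∀ χ : kˣ →* ℂˣ, χ ^ 2 ≠ 1 → ¬ Nonempty (π.Equiv (principalSeries χ)))
    (h : SL(2, k)) :
    ∑ x : k, π (upperMat x * flip h * upperMat (-x)) =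
      ∑ x : k, π (upperMat x * h * upperMat (-x)) := by
  by_cases hc : h 1 0 = 0
  · have hd := borel_det ⟨h, hc⟩
    change h 0 0 * h 1 1 = 1 at hd
    have ha : h 0 0 ≠ 0 := left_ne_zero_of_mul_eq_one hd
    by_cases ha2 : h 0 0 = h 1 1
    · have : flip h = h := ext_entries ha2.symm rfl rfl ha2
      rw [this]
    · have key : ∀ g : SL(2, k), ∀ hg : g ∈ borel k, g 0 0 ≠ g 1 1 →
          ∑ x : k, π (upperMat x * g * upperMat (-x)) =
            π (diagMat (borelDiag k ⟨g, hg⟩)) * ∑ x : k, π (upperMat x) := by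
        intro g hg hne
        have h0 : g 1 0 = 0 := hg
        have hd := borel_det ⟨g, hg⟩
        change g 0 0 * g 1 1 = 1 at hd
        have hn0 : g 0 0 ≠ 0 := left_ne_zero_of_mul_eq_one hd
        have e : ((borelDiag k ⟨g, hg⟩ : kˣ) : k) = g 0 0 := rfl
        have hinv : (g 0 0)⁻¹ = g 1 1 := (eq_inv_of_mul_eq_one_right hd).symm
        have hs : g 1 1 * (g 1 1 - g 0 0) ≠ 0 :=
          mul_ne_zero (right_ne_zero_of_mul_eq_one hd) (sub_ne_zero.mpr hne.symm)
        rw [Finset.mul_sum]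
        -- For g with diagonal a, d and corner b, u(x) g u(-x) = diag(a, d) u(y) with y = d(d - a)x
        -- + db, a bijection in x because a ≠ d.
        refine Fintype.sum_equiv ((Equiv.mulLeft₀ _ hs).trans (Equiv.addRight (g 1 1 * g 0 1)))
          _ _ fun x => ?_
        rw [← map_mul]
        congr 1
        apply ext_entries <;> simp only [mul_entries, upperMat_zero_zero, upperMat_zero_one,
          upperMat_one_zero, upperMat_one_one, diagMat_zero_zero, diagMat_zero_one,
          diagMat_one_zero, diagMat_one_one, e, h0, hinv, Equiv.trans_apply, Equiv.mulLeft₀_apply,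
          Equiv.coe_addRight]
        · ring
        · linear_combination (-(x * (g 1 1 - g 0 0)) - g 0 1) * hd
        · ring
        · ring
      rw [key h hc ha2, key (flip h) hc (fun h' => ha2 h'.symm)]
      have hflip : borelDiag k ⟨flip h, hc⟩ = (borelDiag k ⟨h, hc⟩)⁻¹ :=
        eq_inv_of_mul_eq_one_right (Units.ext hd)
      rw [hflip]
      refine LinearMap.ext fun v => (diagMat_apply_eq_inv hirr hπ (fun y => ?_) _).symm
      rw [LinearMap.sum_apply, map_sum]
      refine Fintype.sum_equiv (Equiv.addLeft y) _ _ fun x => ?_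
      rw [Equiv.coe_addLeft, ← Module.End.mul_apply, ← map_mul, upperMat_mul]
  · refine Fintype.sum_equiv (Equiv.addRight ((h 1 1 - h 0 0) / h 1 0)) _ _ fun x => ?_
    rw [Equiv.coe_addRight, flip_eq_conj_of_ne hc, ← upperMat_mul, neg_add_rev, ← upperMat_mul]
    simp only [mul_assoc]

end TorusAction

/-! ### Endomorphisms of the tensor product -/

open Representation

variable {k : Type*} [Field k] [Fintype k] [DecidableEq k] (hk : ringChar k ≠ 2)
  {ψ : AddChar k ℂ} (hψ : ψ ≠ 1)
  {V : Type*} [AddCommGroup V] [Module ℂ V] {π : Representation ℂ SL(2, k) V}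

/-- The endomorphism `π(h) ⊗ M`. -/
def pureEnd (π : Representation ℂ SL(2, k) V) (h : SL(2, k)) (M : Matrix k k ℂ) :
    Module.End ℂ (TensorProduct ℂ V (k → ℂ)) :=
  TensorProduct.map (π h) (Matrix.toLin' M)

lemma pureEnd_mul (g h : SL(2, k)) (M N : Matrix k k ℂ) :
    pureEnd π g M * pureEnd π h N = pureEnd π (g * h) (M * N) := by
  rw [pureEnd, pureEnd, pureEnd, ← TensorProduct.map_mul, map_mul, Matrix.toLin'_mul]
  rfl

lemma tprod_weilRep_apply (g : SL(2, k)) :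
    (π.tprod (weilRep hk ψ hψ)) g = pureEnd π g (weilMatrix ψ g) := by
  rw [pureEnd, toLin'_weilMatrix]
  rfl

/-- `π(h) ⊗ M` is linear in `M`. -/
def pureEndₗ (π : Representation ℂ SL(2, k) V) (h : SL(2, k)) :
    Matrix k k ℂ →ₗ[ℂ] Module.End ℂ (TensorProduct ℂ V (k → ℂ)) :=
  TensorProduct.mapBilinear (RingHom.id ℂ) V (k → ℂ) V (k → ℂ) (π h) ∘ₗ
    (Matrix.toLin' (R := ℂ) (m := k) (n := k)).toLinearMap

/-- In finite dimension End(V ⊗ W) = End(V) ⊗ End(W), and Burnside's theorem spans End(V) by the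
π(g). -/
lemma span_pureEnd (hirr : π.IsIrreducible) :
    Submodule.span ℂ (Set.range fun p : SL(2, k) × Matrix k k ℂ => pureEnd π p.1 p.2) = ⊤ := by
  have := hirr.finiteDimensional
  rw [Submodule.eq_top_iff']
  intro X
  obtain ⟨t, rfl⟩ := (homTensorHomEquiv ℂ V (k → ℂ) V (k → ℂ)).surjective X
  induction t using TensorProduct.induction_on with
  | zero => rw [map_zero]; exact Submodule.zero_mem _
  | add x y hx hy =>
    rw [map_add]
    exact Submodule.add_mem _ hx hy
  | tmul A B =>
    rw [homTensorHomEquiv_apply]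
    have hA : A ∈ Submodule.span ℂ (Set.range fun g => (π g : Module.End ℂ V)) := by
      rw [hirr.span_range_eq_top]; trivial
    induction hA using Submodule.span_induction with
    | mem A hA =>
      obtain ⟨g, rfl⟩ := hA
      refine Submodule.subset_span ⟨(g, LinearMap.toMatrix' B), ?_⟩
      simp [pureEnd]
    | zero => simp
    | add x y _ _ hx hy =>
      rw [TensorProduct.add_tmul, map_add]
      exact Submodule.add_mem _ hx hy
    | smul c x _ hx =>
      rw [← TensorProduct.smul_tmul', map_smul]
      exact Submodule.smul_mem _ c hx

/-! ### Algebra of group averages -/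

section ConjSum

variable {G W : Type*} [Group G] [Fintype G] [AddCommGroup W] [Module ℂ W]
  (ρ : Representation ℂ G W)

lemma conjSum_eq_sum (X : Module.End ℂ W) : conjSum ρ ρ X = ∑ g : G, ρ g * X * ρ g⁻¹ := by
  rw [conjSum_apply]
  exact Finset.sum_congr rfl fun g _ => (mul_assoc (ρ g) X (ρ g⁻¹)).symm

lemma conjSum_conj (g : G) (X : Module.End ℂ W) :
    conjSum ρ ρ (ρ g * X * ρ g⁻¹) = conjSum ρ ρ X := by
  rw [conjSum_eq_sum, conjSum_eq_sum]
  refine Fintype.sum_equiv (Equiv.mulRight g) _ _ fun h => ?_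
  rw [Equiv.coe_mulRight, mul_inv_rev, map_mul, map_mul]
  simp only [mul_assoc]

lemma commute_conjSum (g : G) (X : Module.End ℂ W) : ρ g * conjSum ρ ρ X = conjSum ρ ρ X * ρ g :=
  comp_conjSum ρ ρ X g

lemma conjSum_mul_of_commute {A : Module.End ℂ W} (hA : ∀ g, ρ g * A = A * ρ g)
    (X : Module.End ℂ W) : conjSum ρ ρ (X * A) = conjSum ρ ρ X * A := by
  rw [conjSum_eq_sum, conjSum_eq_sum, Finset.sum_mul]
  refine Finset.sum_congr rfl fun g _ => ?_
  simp only [mul_assoc, hA]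

lemma conjSum_mul_of_commute_left {A : Module.End ℂ W} (hA : ∀ g, ρ g * A = A * ρ g)
    (X : Module.End ℂ W) : conjSum ρ ρ (A * X) = A * conjSum ρ ρ X := by
  rw [conjSum_eq_sum, conjSum_eq_sum, Finset.mul_sum]
  refine Finset.sum_congr rfl fun g _ => ?_
  rw [← mul_assoc, hA, mul_assoc, mul_assoc, mul_assoc]

/-- An average commutes with the group, so the second factor moves inside the first average and is
then expanded. -/
lemma conjSum_mul_conjSum (X Y : Module.End ℂ W) :
    conjSum ρ ρ X * conjSum ρ ρ Y = ∑ g : G, conjSum ρ ρ (X * (ρ g * Y * ρ g⁻¹)) := by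
  rw [← conjSum_mul_of_commute ρ fun g => commute_conjSum ρ g Y, conjSum_eq_sum ρ Y,
    Finset.mul_sum, map_sum]

lemma conjSum_mul_conjSum' (X Y : Module.End ℂ W) :
    conjSum ρ ρ Y * conjSum ρ ρ X = ∑ g : G, conjSum ρ ρ ((ρ g * Y * ρ g⁻¹) * X) := by
  rw [← conjSum_mul_of_commute_left ρ fun g => commute_conjSum ρ g Y, conjSum_eq_sum ρ Y,
    Finset.sum_mul, map_sum]

lemma conjSum_of_commute {A : Module.End ℂ W} (hA : ∀ g, ρ g * A = A * ρ g) :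
    conjSum ρ ρ A = (Fintype.card G : ℂ) • A := by
  have e : ∀ g : G, ρ g * A * ρ g⁻¹ = A := fun g => by
    rw [hA, mul_assoc, ← map_mul, mul_inv_cancel, map_one, mul_one]
  rw [conjSum_eq_sum, Finset.sum_congr rfl fun g _ => e g, Finset.sum_const, Finset.card_univ,
    Nat.cast_smul_eq_nsmul]

/-- Averaging an intertwiner multiplies it by |G|, so intertwiners are themselves averages up to a
nonzero scalar. -/
lemma intertwiningMap_comm_of_conjSum_comm
    (h : ∀ X Y : Module.End ℂ W,
      conjSum ρ ρ X * conjSum ρ ρ Y = conjSum ρ ρ Y * conjSum ρ ρ X)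
    (A B : IntertwiningMap ρ ρ) : A * B = B * A := by
  have hcomm : ∀ (A : IntertwiningMap ρ ρ) (g : G),
      ρ g * (A.toLinearMap : Module.End ℂ W) = (A.toLinearMap : Module.End ℂ W) * ρ g :=
    fun A g => (A.isIntertwining' g).symm
  have hn : ((Fintype.card G : ℂ) * Fintype.card G) ≠ 0 :=
    mul_ne_zero (Nat.cast_ne_zero.mpr Fintype.card_ne_zero)
      (Nat.cast_ne_zero.mpr Fintype.card_ne_zero)
  have hAB := h A.toLinearMap B.toLinearMap
  rw [conjSum_of_commute ρ (hcomm A), conjSum_of_commute ρ (hcomm B), smul_mul_smul_comm,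
    smul_mul_smul_comm] at hAB
  exact IntertwiningMap.ext (smul_right_injective (Module.End ℂ W) hn hAB)

end ConjSum

/-! ### Invariance under the anti-involution and the Gelfand trick -/

variable (hirr : π.IsIrreducible)
  (hπ : ∀ χ : kˣ →* ℂˣ, χ ^ 2 ≠ 1 → ¬ Nonempty (π.Equiv (principalSeries χ)))

include hirr hπ

/-- Conjugating by u(x) leaves the average and the diagonal factor unchanged, so h may be replaced
by its mean over U-conjugates, where `sum_conj_flip` applies. -/
lemma conjSum_pureEnd_diagonal (h : SL(2, k)) (d : k → ℂ) :
    conjSum (π.tprod (weilRep hk ψ hψ)) (π.tprod (weilRep hk ψ hψ))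
        (pureEnd π (flip h) (Matrix.diagonal d)) =
      conjSum (π.tprod (weilRep hk ψ hψ)) (π.tprod (weilRep hk ψ hψ))
        (pureEnd π h (Matrix.diagonal d)) := by
  have key : ∀ g : SL(2, k), (Fintype.card k : ℂ) •
      conjSum (π.tprod (weilRep hk ψ hψ)) (π.tprod (weilRep hk ψ hψ))
        (pureEnd π g (Matrix.diagonal d)) =
      conjSum (π.tprod (weilRep hk ψ hψ)) (π.tprod (weilRep hk ψ hψ))
        (TensorProduct.map (∑ x : k, π (upperMat x * g * upperMat (-x)))
          (Matrix.toLin' (Matrix.diagonal d))) := by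
    intro g
    have e : ∀ x : k, conjSum (π.tprod (weilRep hk ψ hψ)) (π.tprod (weilRep hk ψ hψ))
        (pureEnd π g (Matrix.diagonal d)) =
      conjSum (π.tprod (weilRep hk ψ hψ)) (π.tprod (weilRep hk ψ hψ))
        (pureEnd π (upperMat x * g * upperMat (-x)) (Matrix.diagonal d)) := by
      intro x
      rw [← conjSum_conj _ (upperMat x), tprod_weilRep_apply, tprod_weilRep_apply, pureEnd_mul,
        pureEnd_mul, upperMat_inv, weilMatrix_upperMat, weilMatrix_upperMat,
        Matrix.diagonal_mul_diagonal, Matrix.diagonal_mul_diagonal]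
      congr 3
      funext ξ
      rw [mul_right_comm, ← AddChar.map_add_eq_mul, neg_mul, add_neg_cancel,
        AddChar.map_zero_eq_one, one_mul]
    have hsum : TensorProduct.map (∑ x : k, π (upperMat x * g * upperMat (-x)))
          (Matrix.toLin' (Matrix.diagonal d)) =
        ∑ x : k, pureEnd π (upperMat x * g * upperMat (-x)) (Matrix.diagonal d) := by
      simp only [pureEnd]
      exact map_sum ((TensorProduct.mapBilinear (RingHom.id ℂ) V (k → ℂ) V (k → ℂ)).flip
        (Matrix.toLin' (Matrix.diagonal d))) _ _
    rw [hsum, map_sum, ← Finset.sum_congr rfl fun x _ => e x, Finset.sum_const, Finset.card_univ,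
      Nat.cast_smul_eq_nsmul]
  have h1 := key (flip h)
  rw [sum_conj_flip hirr hπ, ← key h] at h1
  have h2 := congrArg (fun X => (Fintype.card k : ℂ)⁻¹ • X) h1
  simpa only [smul_smul, inv_mul_cancel₀ card_ne_zero, one_smul] using h2

/-- The average over the group of `π(h) ⊗ M` does not change when the anti-involution is applied
to both factors. -/
lemma conjSum_pureEnd_flip (h : SL(2, k)) (M : Matrix k k ℂ) :
    conjSum (π.tprod (weilRep hk ψ hψ)) (π.tprod (weilRep hk ψ hψ))
        (pureEnd π (flip h) M.transpose) =
      conjSum (π.tprod (weilRep hk ψ hψ)) (π.tprod (weilRep hk ψ hψ)) (pureEnd π h M) := by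
  set ρ := π.tprod (weilRep hk ψ hψ) with hρ
  let f (h : SL(2, k)) : Matrix k k ℂ →ₗ[ℂ] _ :=
    conjSum ρ ρ ∘ₗ pureEndₗ π (flip h) ∘ₗ (Matrix.transposeLinearEquiv k k ℂ ℂ).toLinearMap
  let f' (h : SL(2, k)) : Matrix k k ℂ →ₗ[ℂ] _ := conjSum ρ ρ ∘ₗ pureEndₗ π h
  -- All h are required at once because undoing the conjugation of the matrix factor by ω(g)
  -- replaces h by g⁻¹hg.
  let S : Submodule ℂ (Matrix k k ℂ) := ⨅ h, LinearMap.eqLocus (f h) (f' h)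
  suffices hM : M ∈ S from (Submodule.mem_iInf _).mp hM h
  refine mem_of_weilMatrix_conj hk hψ S (fun g d => (Submodule.mem_iInf _).mpr fun h => ?_) M
  change conjSum ρ ρ (pureEnd π (flip h)
    (weilMatrix ψ g * Matrix.diagonal d * weilMatrix ψ g⁻¹).transpose) = conjSum ρ ρ (pureEnd π h _)
  have e1 : pureEnd π h (weilMatrix ψ g * Matrix.diagonal d * weilMatrix ψ g⁻¹) =
      ρ g * pureEnd π (g⁻¹ * h * g) (Matrix.diagonal d) * ρ g⁻¹ := by
    rw [hρ, tprod_weilRep_apply, tprod_weilRep_apply, pureEnd_mul, pureEnd_mul]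
    congr 1
    group
  have e2 : pureEnd π (flip h) (weilMatrix ψ g * Matrix.diagonal d * weilMatrix ψ g⁻¹).transpose =
      ρ (flip g)⁻¹ * pureEnd π (flip (g⁻¹ * h * g)) (Matrix.diagonal d) * ρ (flip g)⁻¹⁻¹ := by
    rw [hρ, tprod_weilRep_apply, tprod_weilRep_apply, pureEnd_mul, pureEnd_mul,
      Matrix.transpose_mul, Matrix.transpose_mul, Matrix.diagonal_transpose, inv_inv, ← flip_inv,
      weilMatrix_flip, weilMatrix_flip, flip_mul, flip_mul, mul_assoc]
    congr 1
    rw [flip_inv]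
    group
  rw [e1, e2, conjSum_conj, conjSum_conj]
  exact conjSum_pureEnd_diagonal hk hψ hirr hπ _ d

lemma conjSum_pureEnd_comm (h h' : SL(2, k)) (M M' : Matrix k k ℂ) :
    conjSum (π.tprod (weilRep hk ψ hψ)) (π.tprod (weilRep hk ψ hψ)) (pureEnd π h M) *
        conjSum (π.tprod (weilRep hk ψ hψ)) (π.tprod (weilRep hk ψ hψ)) (pureEnd π h' M') =
      conjSum (π.tprod (weilRep hk ψ hψ)) (π.tprod (weilRep hk ψ hψ)) (pureEnd π h' M') *
        conjSum (π.tprod (weilRep hk ψ hψ)) (π.tprod (weilRep hk ψ hψ)) (pureEnd π h M) := by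
  set ρ := π.tprod (weilRep hk ψ hψ) with hρ
  have flipEq : ∀ h M, conjSum ρ ρ (pureEnd π (flip h) (Matrix.transpose M)) =
      conjSum ρ ρ (pureEnd π h M) := conjSum_pureEnd_flip hk hψ hirr hπ
  rw [conjSum_mul_conjSum, ← flipEq h M, ← flipEq h' M', conjSum_mul_conjSum']
  -- The anti-involution turns X ρ(g) Y ρ(g)⁻¹ into ρ(g') Y' ρ(g')⁻¹ X', where g' = `flip g⁻¹` and
  -- X', Y' are the flipped factors; hence the reindexing by `flipInv`.
  refine Fintype.sum_equiv flipInv _ _ fun g => ?_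
  change _ = conjSum ρ ρ (ρ (flip g⁻¹) * _ * ρ (flip g⁻¹)⁻¹ * _)
  rw [← flip_inv, inv_inv, hρ]
  simp only [tprod_weilRep_apply, pureEnd_mul]
  rw [← hρ, ← flipEq]
  simp only [flip_mul, Matrix.transpose_mul, weilMatrix_flip, mul_assoc]

lemma conjSum_comm (X Y : Module.End ℂ (TensorProduct ℂ V (k → ℂ))) :
    conjSum (π.tprod (weilRep hk ψ hψ)) (π.tprod (weilRep hk ψ hψ)) X *
        conjSum (π.tprod (weilRep hk ψ hψ)) (π.tprod (weilRep hk ψ hψ)) Y =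
      conjSum (π.tprod (weilRep hk ψ hψ)) (π.tprod (weilRep hk ψ hψ)) Y *
        conjSum (π.tprod (weilRep hk ψ hψ)) (π.tprod (weilRep hk ψ hψ)) X := by
  have mem : ∀ X, X ∈ Submodule.span ℂ
      (Set.range fun p : SL(2, k) × Matrix k k ℂ => pureEnd π p.1 p.2) := fun X => by
    rw [span_pureEnd hirr]; trivial
  induction mem X using Submodule.span_induction with
  | mem X hX =>
    obtain ⟨p, rfl⟩ := hX
    induction mem Y using Submodule.span_induction with
    | mem Y hY =>
      obtain ⟨p', rfl⟩ := hY
      exact conjSum_pureEnd_comm hk hψ hirr hπ _ _ _ _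
    | zero => rw [map_zero, mul_zero, zero_mul]
    | add _ _ _ _ h₁ h₂ => rw [map_add, mul_add, add_mul, h₁, h₂]
    | smul c _ _ h => rw [map_smul, mul_smul_comm, smul_mul_assoc, h]
  | zero => rw [map_zero, mul_zero, zero_mul]
  | add _ _ _ _ h₁ h₂ => rw [map_add, mul_add, add_mul, h₁, h₂]
  | smul c _ _ h => rw [map_smul, mul_smul_comm, smul_mul_assoc, h]

end SLTwo
end

theorem corollary2p2 {k : Type*} [Field k] [Fintype k] [DecidableEq k] (hk : ringChar k ≠ 2)
    (ψ : AddChar k ℂ) (hψ : ψ ≠ 1)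
    {V : Type*} [AddCommGroup V] [Module ℂ V] (π : Representation ℂ SL(2, k) V)
    (hirr : π.IsIrreducible)
    (hπ : ∀ χ : kˣ →* ℂˣ, χ ^ 2 ≠ 1 → ¬ Nonempty (π.Equiv (SLTwo.principalSeries χ))) :
    Representation.IsMultiplicityFree.{w} (π.tprod (SLTwo.weilRep hk ψ hψ)) :=
  Representation.isMultiplicityFree_of_commute
    (SLTwo.intertwiningMap_comm_of_conjSum_comm _ (SLTwo.conjSum_comm hk hψ hirr hπ))
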